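/- **Proposition 3.1.** Let $I=(-1,1)$ and let $b,f\in H^1(I)$ be such that $b(x)\ge\underline b$ for a.e. $x\in I$, with a constant $\underline b>0$. For $0<\varepsilon\le 1$ put $$B_\varepsilon(w,v)=\int_I\big(\varepsilon^2 w'v'+b\,w v\big)\,dx,\qquad \|w\|_{1,\varepsilon,I}^2=\int_I\big(\varepsilon^2 (w')^2+b\,w^2\big)\,dx,$$ and let $u_\varepsilon\in H^1_0(I)$ be the weak solution of $-\varepsilon^2u_\varepsilon''+b\,u_\varepsilon=f$ in $I$, $u_\varepsilon(\pm1)=0$, that is, $B_\varepsilon(u_\varepsilon,v)=\int_I f v\,dx$ for all $v\in H^1_0(I)$. For $N\in\mathbb N$, $N\ge 1$, divisible by $4$, let $$\lambda=\min\{\theta\,\varepsilon\ln N,\ 1/4\},\qquad \theta=2\beta_*,\qquad \beta_*=2/\sqrt{\underline b},$$ and let the Shishkin mesh $\Delta_S=\{-1=x_0<x_1<\dots<x_N=1\}$ be the mesh which is equidistant on each of $[-1,-1+\lambda]$, $[-1+\lambda,1-\lambda]$ and $[1-\lambda,1]$, with $N/4$, $N/2$ and $N/4$ mesh intervals, respectively.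 Let $\mathcal S^1_0(\Delta_S)$ be the space of all $w\in H^1_0(I)$ that are polynomials of degree at most $1$ on each interval $[x_{j-1},x_j]$, $j=1,\dots,N$, and let $u_\varepsilon^{\Delta_S}\in\mathcal S^1_0(\Delta_S)$ be the Galerkin approximation, that is, $B_\varepsilon(u_\varepsilon^{\Delta_S},v)=\int_I f v\,dx$ for all $v\in \mathcal S^1_0(\Delta_S)$. Then there is a constant $C>0$, independent of $\varepsilon$ and of $N$, such that for every $0<\varepsilon\le 1$ and every such $N$ with $1\le N\le 1/\varepsilon$, $$\|u_\varepsilon-u_\varepsilon^{\Delta_S}\|_{1,\varepsilon,I}\le C\,N^{-1}\ln N .$$ -/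

import Mathlib

open MeasureTheory
open scoped ContDiff

noncomputable section

namespace SingPert

/-- The open interval `I = (-1, 1)`. -/
def dom : Set ℝ := Set.Ioo (-1) 1

/-- `w` and `g` lie in `L²(I)` and `g` is a weak derivative of `w` on `I`, tested against all
smooth functions with compact support in `I`. -/
structure HasWeakDeriv (w g : ℝ → ℝ) : Prop where
  memLp : MemLp w 2 (volume.restrict dom)
  memLp_deriv : MemLp g 2 (volume.restrict dom)
  integral_eq : ∀ φ : ℝ → ℝ, ContDiff ℝ ∞ φ → HasCompactSupport φ → tsupport φ ⊆ dom →
    ∫ x in dom, w x * deriv φ x = - ∫ x in dom, g x * φ x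

/-- `w ∈ H¹(I)`. Elements of `H¹(I)` are represented by functions `ℝ → ℝ`, whose values matter
only almost everywhere on `I`. -/
def MemH1 (w : ℝ → ℝ) : Prop := ∃ g : ℝ → ℝ, HasWeakDeriv w g

open Classical in
/-- The weak derivative `w'` of `w ∈ H¹(I)` (and `0` for any other `w`). It is unique up to
equality almost everywhere on `I`, see `HasWeakDeriv.ae_eq`. -/
def weakDeriv (w : ℝ → ℝ) : ℝ → ℝ := if h : MemH1 w then h.choose else 0

/-- `w ∈ H¹₀(I)`: the function `w ∈ H¹(I)` has vanishing traces, i.e. its continuous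
representative on `[-1, 1]` is zero at both endpoints. -/
def MemH10 (w : ℝ → ℝ) : Prop :=
  MemH1 w ∧ ∃ v : ℝ → ℝ, ContinuousOn v (Set.Icc (-1) 1) ∧ w =ᵐ[volume.restrict dom] v ∧
    v (-1) = 0 ∧ v 1 = 0

/-- The bilinear form `B_ε(w, v) = ∫_I (ε² w' v' + b w v) dx`. -/
def bilin (ε : ℝ) (b w v : ℝ → ℝ) : ℝ :=
  ∫ x in dom, (ε ^ 2 * (weakDeriv w x * weakDeriv v x) + b x * (w x * v x))

/-- The load functional `F(v) = ∫_I f v dx`. -/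
def load (f v : ℝ → ℝ) : ℝ := ∫ x in dom, f x * v x

/-- The energy norm `‖w‖_{1,ε,I} = (∫_I (ε² (w')² + b w²) dx)^{1/2}`. -/
def energyNorm (ε : ℝ) (b w : ℝ → ℝ) : ℝ :=
  Real.sqrt (∫ x in dom, (ε ^ 2 * weakDeriv w x ^ 2 + b x * w x ^ 2))

/-- `u ∈ H¹₀(I)` is the weak solution of `-ε² u'' + b u = f` in `I`, `u(±1) = 0`. -/
def IsWeakSolution (ε : ℝ) (b f u : ℝ → ℝ) : Prop :=
  MemH10 u ∧ ∀ v : ℝ → ℝ, MemH10 v → bilin ε b u v = load f v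

/-- `w ∈ S¹₀(Δ)` for the partition `Δ = {x 0 < x 1 < ... < x N}` of `[-1, 1]`: `w ∈ H¹₀(I)` and
on each mesh interval `w` is a polynomial of degree at most one. -/
def MemP1Zero (N : ℕ) (x : ℕ → ℝ) (w : ℝ → ℝ) : Prop :=
  MemH10 w ∧ ∀ j < N, ∃ α β : ℝ,
    ∀ᵐ t ∂(volume.restrict (Set.Ioo (x j) (x (j + 1)))), w t = α + β * t

/-- `uh ∈ S¹₀(Δ)` is the Galerkin finite element approximation on the partition `Δ`. -/
def IsGalerkin (ε : ℝ) (b f : ℝ → ℝ) (N : ℕ) (x : ℕ → ℝ) (uh : ℝ → ℝ) : Prop :=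
  MemP1Zero N x uh ∧ ∀ v : ℝ → ℝ, MemP1Zero N x v → bilin ε b uh v = load f v

/-- The transition parameter `λ = min {θ ε ln N, 1/4}`. -/
def transition (θ ε : ℝ) (N : ℕ) : ℝ := min (θ * ε * Real.log N) (1 / 4)

/-- The nodes of the Shishkin mesh with `N` intervals (`4 ∣ N`): equidistant in each of the three
intervals `[-1, -1 + λ]`, `[-1 + λ, 1 - λ]` and `[1 - λ, 1]`, with `N / 4`, `N / 2` and `N / 4`
mesh intervals respectively. -/
def shishkinNode (θ ε : ℝ) (N i : ℕ) : ℝ :=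
  if 4 * i ≤ N then -1 + 4 * i / N * transition θ ε N
  else if 4 * i ≤ 3 * N then
    4 * i / N * (1 - transition θ ε N) - 2 + 2 * transition θ ε N
  else 1 - (4 - 4 * i / N) * transition θ ε N

/-- `β_* = 2 / √b_min`, where `b_min` is the lower bound of the reaction coefficient. -/
def betaStar (bmin : ℝ) : ℝ := 2 / Real.sqrt bmin

/-- The Shishkin mesh `Δ_S`: the choice `θ = 2 β_*`. -/
def shishkinMesh (bmin ε : ℝ) (N i : ℕ) : ℝ := shishkinNode (2 * betaStar bmin) ε N i

theorem MemH1.hasWeakDeriv {w : ℝ → ℝ} (h : MemH1 w) : HasWeakDeriv w (weakDeriv w) := by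
  unfold weakDeriv
  rw [dif_pos h]
  exact h.choose_spec

theorem HasWeakDeriv.ae_eq {w g₁ g₂ : ℝ → ℝ} (h₁ : HasWeakDeriv w g₁) (h₂ : HasWeakDeriv w g₂) :
    g₁ =ᵐ[volume.restrict dom] g₂ := by
  have : IsFiniteMeasure (volume.restrict dom) := ⟨by simp [dom]⟩
  have i₁ : IntegrableOn g₁ dom := h₁.memLp_deriv.integrable (by norm_num)
  have i₂ : IntegrableOn g₂ dom := h₂.memLp_deriv.integrable (by norm_num)
  have key := IsOpen.ae_eq_zero_of_integral_contDiff_smul_eq_zero (μ := volume)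
    (U := dom) isOpen_Ioo (f := g₁ - g₂) ((i₁.sub i₂).locallyIntegrableOn) (by
      intro φ hφ hc hs
      have e₁ := h₁.integral_eq φ hφ hc hs
      have e₂ := h₂.integral_eq φ hφ hc hs
      have e : ∫ x in dom, g₁ x * φ x = ∫ x in dom, g₂ x * φ x := by linarith
      obtain ⟨K, hK⟩ := hc.exists_bound_of_continuous hφ.continuous
      have j₁ : IntegrableOn (fun x => g₁ x * φ x) dom :=
        Integrable.mul_bdd i₁ hφ.continuous.aestronglyMeasurable (Filter.Eventually.of_forall hK)
      have j₂ : IntegrableOn (fun x => g₂ x * φ x) dom :=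
        Integrable.mul_bdd i₂ hφ.continuous.aestronglyMeasurable (Filter.Eventually.of_forall hK)
      rw [← setIntegral_eq_integral_of_forall_compl_eq_zero (s := dom)]
      · have : (fun x => φ x • (g₁ - g₂) x) = fun x => g₁ x * φ x - g₂ x * φ x := by
          funext x; simp only [smul_eq_mul, Pi.sub_apply]; ring
        rw [this, integral_sub j₁ j₂, e, sub_self]
      · intro x hx
        have : φ x = 0 := image_eq_zero_of_notMem_tsupport (fun h => hx (hs h))
        simp [this])
  rw [Filter.EventuallyEq, ae_restrict_iff' (show MeasurableSet dom from measurableSet_Ioo)]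
  filter_upwards [key] with x hx hxd
  have := hx hxd
  simpa [sub_eq_zero] using this

end SingPert

end

open MeasureTheory
open scoped ContDiff

namespace SingPert

theorem integral_dom (h : ℝ → ℝ) : ∫ x in dom, h x = ∫ x in (-1 : ℝ)..1, h x := by
  rw [intervalIntegral.integral_of_le (by norm_num), integral_Ioc_eq_integral_Ioo, dom]

theorem measurableSet_dom : MeasurableSet dom := measurableSet_Ioo

instance isFiniteMeasure_restrict_dom : IsFiniteMeasure (volume.restrict dom) := ⟨by simp [dom]⟩

theorem integrableOn_dom_iff {g : ℝ → ℝ} :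
    IntegrableOn g dom ↔ IntervalIntegrable g volume (-1) 1 := by
  rw [intervalIntegrable_iff_integrableOn_Ioo_of_le (by norm_num), dom]

theorem intervalIntegrable_of_memLp_dom {g : ℝ → ℝ} (hg : MemLp g 2 (volume.restrict dom)) :
    IntervalIntegrable g volume (-1) 1 :=
  integrableOn_dom_iff.1 (hg.integrable (by norm_num))

theorem memLp_dom_of_continuousOn {p : ℝ → ℝ} (hp : ContinuousOn p (Set.Icc (-1) 1)) :
    MemLp p 2 (volume.restrict dom) := by
  obtain ⟨K, hK⟩ := isCompact_Icc.exists_bound_of_continuousOn hp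
  apply MemLp.of_bound
    ((hp.mono Set.Ioo_subset_Icc_self).aestronglyMeasurable measurableSet_dom) K
  filter_upwards [ae_restrict_mem measurableSet_dom] with x hx
  exact hK x (Set.Ioo_subset_Icc_self hx)

/-- The absolutely continuous function with value `c` at `-1` and derivative `g`. -/
noncomputable def primitive (c : ℝ) (g : ℝ → ℝ) (x : ℝ) : ℝ := c + ∫ t in (-1 : ℝ)..x, g t

theorem primitive_neg_one (c : ℝ) (g : ℝ → ℝ) : primitive c g (-1) = c := by simp [primitive]

theorem absolutelyContinuous_primitive {g : ℝ → ℝ} (hg : IntervalIntegrable g volume (-1) 1)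
    (c : ℝ) : AbsolutelyContinuousOnInterval (primitive c g) (-1) 1 := by
  have h1 := hg.absolutelyContinuousOnInterval_intervalIntegral (c := -1) (by simp)
  have h2 : AbsolutelyContinuousOnInterval (fun _ : ℝ => c) (-1) 1 :=
    (contDiff_const.contDiffOn).absolutelyContinuousOnInterval
  exact h2.add h1

theorem continuousOn_primitive {g : ℝ → ℝ} (hg : IntervalIntegrable g volume (-1) 1)
    (c : ℝ) : ContinuousOn (primitive c g) (Set.Icc (-1) 1) := by
  have := (absolutelyContinuous_primitive hg c).continuousOn
  rwa [Set.uIcc_of_le (by norm_num)] at this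

theorem intervalIntegrable_mono_Icc {g : ℝ → ℝ} {a b x y : ℝ}
    (hg : IntervalIntegrable g volume a b)
    (hx : x ∈ Set.Icc a b) (hy : y ∈ Set.Icc a b) :
    IntervalIntegrable g volume x y := by
  apply hg.mono_set
  rw [Set.uIcc_of_le (hx.1.trans hx.2)]
  exact Set.uIcc_subset_Icc hx hy

theorem primitive_sub {g : ℝ → ℝ} (hg : IntervalIntegrable g volume (-1) 1) (c : ℝ) {x y : ℝ}
    (hx : x ∈ Set.Icc (-1 : ℝ) 1) (hy : y ∈ Set.Icc (-1 : ℝ) 1) :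
    primitive c g y - primitive c g x = ∫ t in x..y, g t := by
  have hm : (-1 : ℝ) ∈ Set.Icc (-1 : ℝ) 1 := by norm_num
  rw [← intervalIntegral.integral_interval_sub_left (intervalIntegrable_mono_Icc hg hm hy)
    (intervalIntegrable_mono_Icc hg hm hx)]
  simp [primitive]

/-- Integration by parts of a smooth function against a primitive. -/
theorem integral_deriv_mul_primitive {g ψ : ℝ → ℝ} (hg : IntervalIntegrable g volume (-1) 1)
    (hψ : ContDiff ℝ 1 ψ) (c : ℝ) :
    ∫ x in (-1 : ℝ)..1, (deriv ψ x * primitive c g x + ψ x * g x) =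
      ψ 1 * primitive c g 1 - ψ (-1) * c := by
  have h := AbsolutelyContinuousOnInterval.integral_deriv_mul_eq_sub
    (hψ.contDiffOn.absolutelyContinuousOnInterval (a := -1) (b := 1))
    (absolutelyContinuous_primitive hg c)
  rw [primitive_neg_one] at h
  rw [← h]
  apply intervalIntegral.integral_congr_ae
  filter_upwards [hg.ae_hasDerivAt_integral] with x hx hx2
  have h3 := (hx (Set.uIoc_subset_uIcc hx2) (-1) (by simp)).const_add c
  have : deriv (primitive c g) x = g x := h3.deriv
  rw [this]

theorem hasWeakDeriv_primitive {g : ℝ → ℝ} (hg : MemLp g 2 (volume.restrict dom)) (c : ℝ) :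
    HasWeakDeriv (primitive c g) g := by
  have hi := intervalIntegrable_of_memLp_dom hg
  have hc := continuousOn_primitive hi c
  refine ⟨?_, hg, ?_⟩
  · exact memLp_dom_of_continuousOn hc
  · intro φ hφ hcs hs
    have h1 := integral_deriv_mul_primitive hi (hφ.of_le (by norm_cast)) c
    have e1 : φ 1 = 0 := image_eq_zero_of_notMem_tsupport fun h => by simpa [dom] using hs h
    have e2 : φ (-1) = 0 := image_eq_zero_of_notMem_tsupport fun h => by simpa [dom] using hs h
    rw [e1, e2, intervalIntegral.integral_add] at h1
    · rw [integral_dom, integral_dom]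
      simp_rw [mul_comm (primitive c g _), mul_comm (g _)]
      linarith
    · apply ContinuousOn.intervalIntegrable
      rw [Set.uIcc_of_le (by norm_num)]
      exact (hφ.continuous_deriv (by norm_cast)).continuousOn.mul hc
    · exact hi.continuousOn_mul hφ.continuous.continuousOn

theorem exists_subset_Icc_of_compact {K : Set ℝ} (hK : IsCompact K) (h : K ⊆ dom) :
    ∃ r, 1 / 2 ≤ r ∧ r < 1 ∧ K ⊆ Set.Icc (-r) r := by
  rcases K.eq_empty_or_nonempty with rfl | hne
  · exact ⟨1 / 2, le_rfl, by norm_num, by simp⟩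
  · obtain ⟨x, hx, hmax⟩ := hK.exists_isMaxOn hne continuous_abs.continuousOn
    refine ⟨max (1 / 2) |x|, le_max_left _ _, max_lt (by norm_num) (abs_lt.2 (h hx)), ?_⟩
    intro y hy
    exact abs_le.1 ((hmax hy).trans (le_max_right _ _))

/-- A smooth function with vanishing mean, supported inside `I`, is the derivative of a test
function. -/
theorem exists_test_deriv_eq {η : ℝ → ℝ} (hη : ContDiff ℝ ∞ η) {r : ℝ} (hr : r < 1)
    (hs : ∀ x, x ∉ Set.Icc (-r) r → η x = 0) (hint : ∫ x in (-1 : ℝ)..1, η x = 0) :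
    ∃ φ : ℝ → ℝ, ContDiff ℝ ∞ φ ∧ HasCompactSupport φ ∧ tsupport φ ⊆ dom ∧ deriv φ = η := by
  have hd : ∀ x, HasDerivAt (fun x => ∫ t in (-1 : ℝ)..x, η t) (η x) x := fun x =>
    intervalIntegral.integral_hasDerivAt_right (hη.continuous.intervalIntegrable _ _)
      (hη.continuous.stronglyMeasurableAtFilter _ _) hη.continuous.continuousAt
  have hd' : deriv (fun x => ∫ t in (-1 : ℝ)..x, η t) = η := funext fun x => (hd x).deriv
  have h0 : ∀ x, x ∉ Set.Icc (-r) r → ∫ t in (-1 : ℝ)..x, η t = 0 := by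
    intro x hx
    rw [Set.mem_Icc, not_and_or, not_le, not_le] at hx
    rcases hx with hx | hx
    · rw [intervalIntegral.integral_congr (g := fun _ => 0)]
      · simp
      · intro t ht
        apply hs
        intro h
        have := ht.2
        rcases le_max_iff.1 this with h' | h' <;> linarith [h.1]
    · rw [← intervalIntegral.integral_add_adjacent_intervals
        (hη.continuous.intervalIntegrable _ 1) (hη.continuous.intervalIntegrable _ _), hint,
        zero_add, intervalIntegral.integral_congr (g := fun _ => 0)]
      · simp
      · intro t ht
        apply hs
        intro h
        have := ht.1
        rcases min_le_iff.1 this with h' | h' <;> linarith [h.2]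
  have hsub : tsupport (fun x => ∫ t in (-1 : ℝ)..x, η t) ⊆ Set.Icc (-r) r := by
    apply closure_minimal _ isClosed_Icc
    intro x hx
    by_contra h
    exact hx (h0 x h)
  refine ⟨_, ?_, ?_, hsub.trans ?_, hd'⟩
  · rw [contDiff_infty_iff_deriv, hd']
    exact ⟨fun x => (hd x).differentiableAt, hη⟩
  · exact isCompact_Icc.of_isClosed_subset (isClosed_tsupport _) hsub
  · intro x hx
    exact ⟨by linarith [hx.1], by linarith [hx.2]⟩

/-- The lemma of du Bois-Reymond on `I`. -/
theorem ae_eq_const_of_integral_mul_deriv_eq_zero {z : ℝ → ℝ} (hz : IntegrableOn z dom)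
    (h : ∀ φ : ℝ → ℝ, ContDiff ℝ ∞ φ → HasCompactSupport φ → tsupport φ ⊆ dom →
      ∫ x in dom, z x * deriv φ x = 0) :
    ∃ c : ℝ, z =ᵐ[volume.restrict dom] fun _ => c := by
  let f : ContDiffBump (0 : ℝ) := ⟨1 / 4, 1 / 2, by norm_num, by norm_num⟩
  set ψ₀ : ℝ → ℝ := f.normed volume with hψ₀
  have s₀ : ContDiff ℝ ∞ ψ₀ := f.contDiff_normed
  have z₀ : ∀ x, x ∉ Set.Icc (-(1 / 2) : ℝ) (1 / 2) → ψ₀ x = 0 := by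
    intro x hx
    by_contra h
    have : x ∈ Function.support ψ₀ := h
    rw [hψ₀, f.support_normed_eq, Real.ball_eq_Ioo] at this
    have h2 : f.rOut = 1 / 2 := rfl
    rw [h2] at this
    exact hx ⟨by linarith [this.1], by linarith [this.2]⟩
  have whole : ∀ (φ : ℝ → ℝ) (r : ℝ), r < 1 → (∀ x, x ∉ Set.Icc (-r) r → φ x = 0) →
      ∫ x in dom, φ x = ∫ x, φ x := by
    intro φ r hr h0
    apply setIntegral_eq_integral_of_forall_compl_eq_zero
    intro x hx
    exact h0 x fun h => hx ⟨by linarith [h.1], by linarith [h.2]⟩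
  have i₀ : ∫ x in dom, ψ₀ x = 1 := by
    rw [whole ψ₀ (1 / 2) (by norm_num) z₀]
    exact f.integral_normed
  have bdd : ∀ φ : ℝ → ℝ, Continuous φ → IntegrableOn (fun x => z x * φ x) dom := by
    intro φ hφ
    rw [integrableOn_dom_iff]
    exact (integrableOn_dom_iff.1 hz).mul_continuousOn hφ.continuousOn
  have cint : ∀ φ : ℝ → ℝ, Continuous φ → IntegrableOn φ dom := fun φ hφ =>
    integrableOn_dom_iff.2 (hφ.intervalIntegrable _ _)
  set c := ∫ x in dom, z x * ψ₀ x with hc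
  refine ⟨c, ?_⟩
  have key := IsOpen.ae_eq_zero_of_integral_contDiff_smul_eq_zero (μ := volume)
    (U := dom) isOpen_Ioo (f := fun x => z x - c)
    ((hz.sub (integrable_const c)).locallyIntegrableOn) (by
      intro ψ hψ hcs hs
      obtain ⟨r, hr0, hr, hK⟩ := exists_subset_Icc_of_compact hcs hs
      have zψ : ∀ x, x ∉ Set.Icc (-r) r → ψ x = 0 := fun x hx =>
        image_eq_zero_of_notMem_tsupport fun h => hx (hK h)
      set m := ∫ x in dom, ψ x with hm
      have hcη : ContDiff ℝ ∞ (fun x => ψ x - m * ψ₀ x) := hψ.sub (contDiff_const.mul s₀)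
      obtain ⟨φ, h1, h2, h3, h4⟩ := exists_test_deriv_eq hcη hr
        (by
          intro x hx
          rw [zψ x hx, z₀ x fun h => hx ⟨by linarith [h.1], by linarith [h.2]⟩]
          simp)
        (by
          rw [← integral_dom, integral_sub (cint _ hψ.continuous)
            ((cint _ s₀.continuous).const_mul m), integral_const_mul, i₀]
          simp [hm])
      have h5 := h φ h1 h2 h3
      rw [h4] at h5
      have e : (fun x => z x * (ψ x - m * ψ₀ x)) = fun x => z x * ψ x - m * (z x * ψ₀ x) := by
        funext x; ring
      rw [e, integral_sub (bdd _ hψ.continuous) ((bdd _ s₀.continuous).const_mul m),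
        integral_const_mul, ← hc] at h5
      rw [← whole (fun x => ψ x • (z x - c)) r hr (by intro x hx; simp [zψ x hx])]
      have e : (fun x => ψ x • (z x - c)) = fun x => z x * ψ x - c * ψ x := by
        funext x; simp only [smul_eq_mul]; ring
      rw [e, integral_sub (bdd _ hψ.continuous) ((cint _ hψ.continuous).const_mul c),
        integral_const_mul, ← hm]
      linarith)
  rw [Filter.EventuallyEq, ae_restrict_iff' measurableSet_dom]
  filter_upwards [key] with x hx hxd
  linarith [hx hxd]

/-- Every `H¹` function has an absolutely continuous representative. -/
theorem HasWeakDeriv.exists_primitive {w g : ℝ → ℝ} (h : HasWeakDeriv w g) :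
    ∃ c : ℝ, w =ᵐ[volume.restrict dom] primitive c g := by
  have hp := hasWeakDeriv_primitive h.memLp_deriv 0
  have hw : IntegrableOn w dom := h.memLp.integrable (by norm_num)
  have hpi : IntegrableOn (primitive 0 g) dom := hp.memLp.integrable (by norm_num)
  obtain ⟨c, hc⟩ := ae_eq_const_of_integral_mul_deriv_eq_zero (hw.sub hpi) (by
    intro φ hφ hcs hs
    have hcont := (hφ.continuous_deriv (by norm_cast)).continuousOn
      (s := Set.uIcc (-1) 1)
    have i1 : IntegrableOn (fun x => w x * deriv φ x) dom :=
      integrableOn_dom_iff.2 ((integrableOn_dom_iff.1 hw).mul_continuousOn hcont)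
    have i2 : IntegrableOn (fun x => primitive 0 g x * deriv φ x) dom :=
      integrableOn_dom_iff.2 ((integrableOn_dom_iff.1 hpi).mul_continuousOn hcont)
    have := integral_sub i1 i2
    rw [h.integral_eq φ hφ hcs hs, hp.integral_eq φ hφ hcs hs, sub_self] at this
    refine Eq.trans (integral_congr_ae ?_) this
    filter_upwards with x
    simp only [Pi.sub_apply]; ring)
  refine ⟨c, ?_⟩
  filter_upwards [hc] with x hx
  simp only [Pi.sub_apply, primitive] at hx ⊢
  linarith

theorem eqOn_Icc_of_ae_eq {v₁ v₂ : ℝ → ℝ} (h₁ : ContinuousOn v₁ (Set.Icc (-1) 1))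
    (h₂ : ContinuousOn v₂ (Set.Icc (-1) 1)) (h : v₁ =ᵐ[volume.restrict dom] v₂) :
    Set.EqOn v₁ v₂ (Set.Icc (-1) 1) := by
  have h' : v₁ =ᵐ[volume.restrict (Set.Icc (-1) 1)] v₂ := by
    rwa [← restrict_Ioo_eq_restrict_Icc]
  exact Measure.eqOn_Icc_of_ae_eq volume (by norm_num) h' h₁ h₂

/-- The representative of an `H¹₀` function vanishes at both endpoints. -/
theorem MemH10.exists_primitive {w g : ℝ → ℝ} (h : MemH10 w) (hg : HasWeakDeriv w g) :
    w =ᵐ[volume.restrict dom] primitive 0 g ∧ primitive 0 g 1 = 0 := by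
  obtain ⟨c, hc⟩ := hg.exists_primitive
  obtain ⟨_, v, hv, hwv, h1, h2⟩ := h
  have hcont := continuousOn_primitive (intervalIntegrable_of_memLp_dom hg.memLp_deriv) c
  have := eqOn_Icc_of_ae_eq hv hcont (hwv.symm.trans hc)
  have e1 := this (show (-1 : ℝ) ∈ Set.Icc (-1 : ℝ) 1 by norm_num)
  have e2 := this (show (1 : ℝ) ∈ Set.Icc (-1 : ℝ) 1 by norm_num)
  rw [primitive_neg_one, h1] at e1
  subst e1
  exact ⟨hc, by rw [← e2, h2]⟩

theorem memH10_primitive {g : ℝ → ℝ} (hg : MemLp g 2 (volume.restrict dom))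
    (h1 : primitive 0 g 1 = 0) : MemH10 (primitive 0 g) :=
  ⟨⟨g, hasWeakDeriv_primitive hg 0⟩, primitive 0 g,
    continuousOn_primitive (intervalIntegrable_of_memLp_dom hg) 0, Filter.EventuallyEq.rfl,
    primitive_neg_one 0 g, h1⟩

theorem HasWeakDeriv.sub {w₁ w₂ g₁ g₂ : ℝ → ℝ} (h₁ : HasWeakDeriv w₁ g₁)
    (h₂ : HasWeakDeriv w₂ g₂) : HasWeakDeriv (w₁ - w₂) (g₁ - g₂) := by
  refine ⟨h₁.memLp.sub h₂.memLp, h₁.memLp_deriv.sub h₂.memLp_deriv, ?_⟩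
  intro φ hφ hcs hs
  have key : ∀ u : ℝ → ℝ, MemLp u 2 (volume.restrict dom) → ∀ ψ : ℝ → ℝ, Continuous ψ →
      IntegrableOn (fun x => u x * ψ x) dom := fun u hu ψ hψ =>
    integrableOn_dom_iff.2 ((intervalIntegrable_of_memLp_dom hu).mul_continuousOn hψ.continuousOn)
  have hd := hφ.continuous_deriv (by norm_cast)
  simp only [Pi.sub_apply, sub_mul]
  rw [integral_sub (key _ h₁.memLp _ hd) (key _ h₂.memLp _ hd),
    integral_sub (key _ h₁.memLp_deriv _ hφ.continuous)
      (key _ h₂.memLp_deriv _ hφ.continuous),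
    h₁.integral_eq φ hφ hcs hs, h₂.integral_eq φ hφ hcs hs]
  ring

theorem MemH10.sub {w₁ w₂ : ℝ → ℝ} (h₁ : MemH10 w₁) (h₂ : MemH10 w₂) : MemH10 (w₁ - w₂) := by
  obtain ⟨⟨g₁, hg₁⟩, v₁, c₁, e₁, l₁, r₁⟩ := h₁
  obtain ⟨⟨g₂, hg₂⟩, v₂, c₂, e₂, l₂, r₂⟩ := h₂
  exact ⟨⟨_, hg₁.sub hg₂⟩, v₁ - v₂, c₁.sub c₂, e₁.sub e₂, by simp [l₁, l₂], by simp [r₁, r₂]⟩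

theorem integrable_mul_of_memLp {p q : ℝ → ℝ} (hp : MemLp p 2 (volume.restrict dom))
    (hq : MemLp q 2 (volume.restrict dom)) : IntegrableOn (fun x => p x * q x) dom :=
  hp.integrable_mul hq

theorem integrable_energy {b p q p' q' : ℝ → ℝ} {M : ℝ} (ε : ℝ)
    (hbm : AEStronglyMeasurable b (volume.restrict dom))
    (hbM : ∀ᵐ x ∂(volume.restrict dom), ‖b x‖ ≤ M)
    (hp : MemLp p 2 (volume.restrict dom)) (hq : MemLp q 2 (volume.restrict dom))
    (hp' : MemLp p' 2 (volume.restrict dom)) (hq' : MemLp q' 2 (volume.restrict dom)) :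
    IntegrableOn (fun x => ε ^ 2 * (p' x * q' x) + b x * (p x * q x)) dom :=
  ((integrable_mul_of_memLp hp' hq').const_mul _).add
    ((integrable_mul_of_memLp hp hq).bdd_mul hbm hbM)

theorem integral_le_of_ae_le_add {F G H : ℝ → ℝ} (hF : IntegrableOn F dom)
    (hG : IntegrableOn G dom) (hH : IntegrableOn H dom) (h0 : ∫ t in dom, H t = 0)
    (h : ∀ᵐ t ∂(volume.restrict dom), F t ≤ G t + H t) :
    ∫ t in dom, F t ≤ ∫ t in dom, G t := by
  rw [← add_zero (∫ t in dom, G t), ← h0, ← integral_add hG hH]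
  exact integral_mono_ae hF (hG.add hH) h

theorem MemH10.hasWeakDeriv {w : ℝ → ℝ} (h : MemH10 w) : HasWeakDeriv w (weakDeriv w) :=
  h.1.hasWeakDeriv

theorem memP1Zero_sub {N : ℕ} {x : ℕ → ℝ} {v w : ℝ → ℝ} (hv : MemP1Zero N x v)
    (hw : MemP1Zero N x w) : MemP1Zero N x (v - w) := by
  refine ⟨hv.1.sub hw.1, fun j hj => ?_⟩
  obtain ⟨a, b, h⟩ := hv.2 j hj
  obtain ⟨a', b', h'⟩ := hw.2 j hj
  refine ⟨a - a', b - b', ?_⟩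
  filter_upwards [h, h'] with t ht ht'
  simp only [Pi.sub_apply, ht, ht']
  ring

/-- Galerkin orthogonality: the Galerkin solution is the best approximation in the energy norm. -/
theorem energy_le_of_isGalerkin {ε M : ℝ} {b f u uh V gV : ℝ → ℝ} {N : ℕ} {x : ℕ → ℝ}
    (hbm : AEStronglyMeasurable b (volume.restrict dom))
    (hb0 : ∀ᵐ x ∂(volume.restrict dom), 0 ≤ b x)
    (hbM : ∀ᵐ x ∂(volume.restrict dom), ‖b x‖ ≤ M)
    (hu : IsWeakSolution ε b f u) (huh : IsGalerkin ε b f N x uh) (hV : MemP1Zero N x V)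
    (hgV : HasWeakDeriv V gV) :
    ∫ t in dom, (ε ^ 2 * weakDeriv (u - uh) t ^ 2 + b t * (u - uh) t ^ 2) ≤
      ∫ t in dom, (ε ^ 2 * (weakDeriv u t - gV t) ^ 2 + b t * (u t - V t) ^ 2) := by
  have hD := memP1Zero_sub huh.1 hV
  have o1 := hu.2 _ hD.1
  have o2 := huh.2 _ hD
  have du := hu.1.hasWeakDeriv
  have duh := huh.1.1.hasWeakDeriv
  have dD := hD.1.hasWeakDeriv
  have de := (hu.1.sub huh.1.1).hasWeakDeriv
  have eD := dD.ae_eq (duh.sub hgV)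
  have ee := de.ae_eq (du.sub duh)
  have i1 := integrable_energy ε hbm hbM du.memLp dD.memLp du.memLp_deriv dD.memLp_deriv
  have i2 := integrable_energy ε hbm hbM duh.memLp dD.memLp duh.memLp_deriv dD.memLp_deriv
  have i3 := integrable_energy ε hbm hbM de.memLp de.memLp de.memLp_deriv de.memLp_deriv
  have i4 := integrable_energy ε hbm hbM (du.sub hgV).memLp (du.sub hgV).memLp
    (du.sub hgV).memLp_deriv (du.sub hgV).memLp_deriv
  have i3' : IntegrableOn
      (fun t => ε ^ 2 * weakDeriv (u - uh) t ^ 2 + b t * (u - uh) t ^ 2) dom := by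
    simpa only [sq] using i3
  apply integral_le_of_ae_le_add i3' _ ((i2.const_mul 2).sub (i1.const_mul 2))
  · have := o1.trans o2.symm
    unfold bilin at this
    refine (integral_sub (i2.const_mul 2) (i1.const_mul 2)).trans ?_
    rw [integral_const_mul, integral_const_mul, this, sub_self]
  · filter_upwards [eD, ee, hb0] with t h1 h2 h3
    simp only [Pi.sub_apply] at h1 h2 ⊢
    rw [h1, h2]
    nlinarith [mul_nonneg h3 (sq_nonneg (uh t - V t)),
      mul_nonneg (sq_nonneg ε) (sq_nonneg (weakDeriv uh t - gV t))]
  · simpa only [sq, Pi.sub_apply] using i4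

/-- The energy of `u - V` is bounded by the residual of `V`. The residual may be shifted by
`ε² (ψ' , ψ)`, which annihilates `H¹₀(I)`. -/
theorem energy_le_residual {ε M bmin : ℝ} {b f u V gV ψ : ℝ → ℝ} (hbmin : 0 < bmin)
    (hbm : AEStronglyMeasurable b (volume.restrict dom))
    (hlower : ∀ᵐ x ∂(volume.restrict dom), bmin ≤ b x)
    (hbM : ∀ᵐ x ∂(volume.restrict dom), ‖b x‖ ≤ M)
    (hf : MemLp f 2 (volume.restrict dom))
    (hu : IsWeakSolution ε b f u) (hV : MemH10 V) (hgV : HasWeakDeriv V gV)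
    (hψ : ContDiff ℝ 1 ψ) :
    ∫ t in dom, (ε ^ 2 * (weakDeriv u t - gV t) ^ 2 + b t * (u t - V t) ^ 2) ≤
      ∫ t in dom, ((f t - b t * V t + ε ^ 2 * deriv ψ t) ^ 2 / bmin +
        ε ^ 2 * (ψ t - gV t) ^ 2) := by
  have he := hu.1.sub hV
  have o1 := hu.2 _ he
  have du := hu.1.hasWeakDeriv
  have de := he.hasWeakDeriv
  have ds := du.sub hgV
  have ee := de.ae_eq ds
  obtain ⟨r1, r2⟩ := he.exists_primitive ds
  have ibp := integral_deriv_mul_primitive (intervalIntegrable_of_memLp_dom ds.memLp_deriv) hψ 0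
  rw [r2, ← integral_dom] at ibp
  simp only [mul_zero, sub_self] at ibp
  have lψ := memLp_dom_of_continuousOn hψ.continuous.continuousOn
  have lψ' := memLp_dom_of_continuousOn (hψ.continuous_deriv le_rfl).continuousOn
  have lbV : MemLp (fun t => b t * V t) 2 (volume.restrict dom) := by
    apply MemLp.of_le_mul (c := M) hgV.memLp (hbm.mul hgV.memLp.1)
    filter_upwards [hbM] with t ht
    rw [Pi.mul_apply, norm_mul]
    exact mul_le_mul_of_nonneg_right ht (norm_nonneg _)
  have lA0 : MemLp (fun t => f t - b t * V t + ε ^ 2 * deriv ψ t) 2 (volume.restrict dom) :=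
    (hf.sub lbV).add (lψ'.const_mul _)
  have lA1 : MemLp (fun t => ψ t - gV t) 2 (volume.restrict dom) := lψ.sub hgV.memLp_deriv
  have i1 := integrable_energy ε hbm hbM du.memLp de.memLp du.memLp_deriv de.memLp_deriv
  have i2 := integrable_mul_of_memLp hf de.memLp
  have i3 : IntegrableOn (fun t => ε ^ 2 * (deriv ψ t * primitive 0 (weakDeriv u - gV) t +
      ψ t * (weakDeriv u - gV) t)) dom :=
    ((integrable_mul_of_memLp lψ' (hasWeakDeriv_primitive ds.memLp_deriv 0).memLp).add
      (integrable_mul_of_memLp lψ ds.memLp_deriv)).const_mul _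
  have i4 : IntegrableOn (fun t => (f t - b t * V t + ε ^ 2 * deriv ψ t) ^ 2 / bmin +
        ε ^ 2 * (ψ t - gV t) ^ 2) dom :=
    (lA0.integrable_sq.div_const _).add (lA1.integrable_sq.const_mul _)
  have i5 : IntegrableOn
      (fun t => ε ^ 2 * (weakDeriv u t - gV t) ^ 2 + b t * (u t - V t) ^ 2) dom := by
    have := integrable_energy ε hbm hbM ds.memLp ds.memLp ds.memLp_deriv ds.memLp_deriv
    simpa only [sq, Pi.sub_apply] using this
  have : ∫ t in dom, 2 * (ε ^ 2 * (weakDeriv u t - gV t) ^ 2 + b t * (u t - V t) ^ 2) ≤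
      ∫ t in dom, ((ε ^ 2 * (weakDeriv u t - gV t) ^ 2 + b t * (u t - V t) ^ 2) +
      ((f t - b t * V t + ε ^ 2 * deriv ψ t) ^ 2 / bmin + ε ^ 2 * (ψ t - gV t) ^ 2)) := by
    apply integral_le_of_ae_le_add (i5.const_mul 2) (i5.add i4) (((i1.sub i2).sub i3).const_mul 2)
    · rw [integral_const_mul]
      refine mul_eq_zero_of_right _ ((integral_sub (i1.sub i2) i3).trans ?_)
      rw [integral_const_mul, ibp, mul_zero, sub_zero]
      exact (integral_sub i1 i2).trans (sub_eq_zero.2 o1)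
    filter_upwards [ee, hlower, r1] with t h1 h2 h3
    simp only [Pi.sub_apply, Pi.add_apply] at h1 h3 ⊢
    rw [h1, ← h3]
    set A := f t - b t * V t + ε ^ 2 * deriv ψ t with hA
    set E := u t - V t with hE
    have y0 : 2 * (A * E) ≤ A ^ 2 / bmin + b t * E ^ 2 := by
      have y1 : A ^ 2 / bmin + bmin * E ^ 2 - 2 * (A * E) = (A - bmin * E) ^ 2 / bmin := by
        field_simp; ring
      have y2 : 0 ≤ (A - bmin * E) ^ 2 / bmin := by positivity
      nlinarith [mul_le_mul_of_nonneg_right h2 (sq_nonneg E)]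
    have y3 := mul_nonneg (sq_nonneg ε) (sq_nonneg ((ψ t - gV t) - (weakDeriv u t - gV t)))
    have y4 : f t = A + b t * V t - ε ^ 2 * deriv ψ t := by rw [hA]; ring
    have y5 : u t = E + V t := by rw [hE]; ring
    rw [y4, y5]
    linarith
  rw [integral_add i5 i4, integral_const_mul] at this
  linarith

/-- `-1 = x 0 < x 1 < ... < x N = 1`. -/
structure IsPartition (N : ℕ) (x : ℕ → ℝ) : Prop where
  left : x 0 = -1
  right : x N = 1
  lt : ∀ j < N, x j < x (j + 1)

theorem IsPartition.mono {N : ℕ} {x : ℕ → ℝ} (h : IsPartition N x) {i j : ℕ} (hij : i ≤ j)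
    (hj : j ≤ N) : x i ≤ x j := by
  induction j, hij using Nat.le_induction with
  | base => exact le_rfl
  | succ k _ ih => exact (ih (by omega)).trans (h.lt k (by omega)).le

theorem IsPartition.mem_Icc {N : ℕ} {x : ℕ → ℝ} (h : IsPartition N x) {j : ℕ} (hj : j ≤ N) :
    x j ∈ Set.Icc (-1 : ℝ) 1 := by
  constructor
  · rw [← h.left]; exact h.mono (Nat.zero_le _) hj
  · rw [← h.right]; exact h.mono hj le_rfl

theorem IsPartition.mem_Icc_of_mem {N : ℕ} {x : ℕ → ℝ} (h : IsPartition N x) {j : ℕ} (hj : j < N)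
    {t : ℝ} (ht : t ∈ Set.Icc (x j) (x (j + 1))) : t ∈ Set.Icc (-1 : ℝ) 1 :=
  ⟨(h.mem_Icc hj.le).1.trans ht.1, ht.2.trans (h.mem_Icc (Nat.succ_le_of_lt hj)).2⟩

theorem IsPartition.exists_mem {N : ℕ} {x : ℕ → ℝ} (h : IsPartition N x) {t : ℝ}
    (ht : t ∈ dom) : ∃ j < N, t ∈ Set.Ioc (x j) (x (j + 1)) := by
  by_contra! hcon
  have : ∀ j ≤ N, x j < t := by
    intro j
    induction j with
    | zero => intro _; rw [h.left]; exact ht.1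
    | succ k ih =>
      intro hk
      by_contra! h2
      exact hcon k (by omega) ⟨ih (by omega), h2⟩
  have := this N le_rfl
  rw [h.right] at this
  exact absurd ht.2 this.le.not_gt

theorem IsPartition.sum_integral {N : ℕ} {x : ℕ → ℝ} (h : IsPartition N x) {g : ℝ → ℝ}
    (hg : IntegrableOn g dom) :
    ∑ j ∈ Finset.range N, ∫ t in (x j)..(x (j + 1)), g t = ∫ t in dom, g t := by
  rw [intervalIntegral.sum_integral_adjacent_intervals, h.left, h.right, integral_dom]
  intro k hk
  exact intervalIntegrable_mono_Icc (integrableOn_dom_iff.1 hg) (h.mem_Icc hk.le)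
    (h.mem_Icc (Nat.succ_le_of_lt hk))

theorem IsPartition.integral_le {N : ℕ} {x : ℕ → ℝ} (h : IsPartition N x) {f g : ℝ → ℝ} {K : ℝ}
    (hf : IntegrableOn f dom) (hg : IntegrableOn g dom)
    (hfg : ∀ j < N, ∫ t in (x j)..(x (j + 1)), f t ≤ K * ∫ t in (x j)..(x (j + 1)), g t) :
    ∫ t in dom, f t ≤ K * ∫ t in dom, g t := by
  rw [← h.sum_integral hf, ← h.sum_integral hg, Finset.mul_sum]
  exact Finset.sum_le_sum fun j hj => hfg j (Finset.mem_range.1 hj)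

/-- The slope of the interpolant of `p` on the `j`-th interval. -/
noncomputable def interpSlope (x : ℕ → ℝ) (p : ℝ → ℝ) (j : ℕ) : ℝ :=
  (p (x (j + 1)) - p (x j)) / (x (j + 1) - x j)

/-- The derivative of the piecewise linear interpolant. -/
noncomputable def interpDeriv (N : ℕ) (x : ℕ → ℝ) (p : ℝ → ℝ) (t : ℝ) : ℝ :=
  ∑ j ∈ Finset.range N,
    (Set.Ioc (x j) (x (j + 1))).indicator (fun _ => interpSlope x p j) t

/-- The piecewise linear interpolant. -/
noncomputable def interp (N : ℕ) (x : ℕ → ℝ) (p : ℝ → ℝ) : ℝ → ℝ :=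
  primitive (p (-1)) (interpDeriv N x p)

/-- The linear polynomial interpolating `p` at both ends of the `j`-th interval. -/
noncomputable def localInterp (x : ℕ → ℝ) (p : ℝ → ℝ) (j : ℕ) (t : ℝ) : ℝ :=
  p (x j) + interpSlope x p j * (t - x j)

theorem IsPartition.interpDeriv_eq {N : ℕ} {x : ℕ → ℝ} (h : IsPartition N x) (p : ℝ → ℝ) {j : ℕ}
    (hj : j < N) {t : ℝ} (ht : t ∈ Set.Ioc (x j) (x (j + 1))) :
    interpDeriv N x p t = interpSlope x p j := by
  unfold interpDeriv
  rw [Finset.sum_eq_single j]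
  · rw [Set.indicator_of_mem ht]
  · intro i hi hij
    apply Set.indicator_of_notMem
    intro hti
    rcases lt_or_gt_of_ne hij with h1 | h1
    · have := h.mono (i := i + 1) (j := j) h1 hj.le
      linarith [hti.2, ht.1]
    · have := h.mono (i := j + 1) (j := i) h1 (Finset.mem_range.1 hi).le
      linarith [hti.1, ht.2]
  · intro h1; simp [hj] at h1

theorem memLp_interpDeriv (N : ℕ) (x : ℕ → ℝ) (p : ℝ → ℝ) :
    MemLp (interpDeriv N x p) 2 (volume.restrict dom) := by
  unfold interpDeriv
  exact memLp_finsetSum (Finset.range N) fun j _ => (memLp_const _).indicator measurableSet_Ioc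

theorem hasWeakDeriv_interp (N : ℕ) (x : ℕ → ℝ) (p : ℝ → ℝ) :
    HasWeakDeriv (interp N x p) (interpDeriv N x p) :=
  hasWeakDeriv_primitive (memLp_interpDeriv N x p) _

theorem IsPartition.interp_sub {N : ℕ} {x : ℕ → ℝ} (h : IsPartition N x) (p : ℝ → ℝ) {j : ℕ}
    (hj : j < N) {t : ℝ} (ht : t ∈ Set.Icc (x j) (x (j + 1))) :
    interp N x p t = interp N x p (x j) + interpSlope x p j * (t - x j) := by
  have := primitive_sub (intervalIntegrable_of_memLp_dom (memLp_interpDeriv N x p))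
    (p (-1))
    (h.mem_Icc hj.le) (h.mem_Icc_of_mem hj ht)
  rw [intervalIntegral.integral_congr_ae (g := fun _ => interpSlope x p j)] at this
  · rw [intervalIntegral.integral_const, smul_eq_mul] at this
    unfold interp
    linarith
  · filter_upwards with s hs
    rw [Set.uIoc_of_le ht.1] at hs
    exact h.interpDeriv_eq p hj ⟨hs.1, hs.2.trans ht.2⟩

theorem IsPartition.interp_node {N : ℕ} {x : ℕ → ℝ} (h : IsPartition N x) (p : ℝ → ℝ)
    {j : ℕ} (hj : j ≤ N) : interp N x p (x j) = p (x j) := by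
  induction j with
  | zero => rw [h.left]; exact primitive_neg_one _ _
  | succ k ih =>
    have hlt := h.lt k hj
    rw [h.interp_sub p hj ⟨hlt.le, le_rfl⟩, ih (by omega), interpSlope,
      div_mul_cancel₀ _ (sub_pos.2 hlt).ne']
    ring

theorem IsPartition.interp_eq {N : ℕ} {x : ℕ → ℝ} (h : IsPartition N x) (p : ℝ → ℝ)
    {j : ℕ} (hj : j < N) {t : ℝ} (ht : t ∈ Set.Icc (x j) (x (j + 1))) :
    interp N x p t = localInterp x p j t := by
  rw [h.interp_sub p hj ht, h.interp_node p hj.le, localInterp]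

theorem IsPartition.memP1Zero_interp {N : ℕ} {x : ℕ → ℝ} (h : IsPartition N x) {p : ℝ → ℝ}
    (hp : p (-1) = 0) (hp' : p 1 = 0) : MemP1Zero N x (interp N x p) := by
  have h1 := h.interp_node p le_rfl
  refine ⟨?_, fun j hj =>
    ⟨p (x j) - interpSlope x p j * x j, interpSlope x p j, ?_⟩⟩
  · rw [h.right, hp'] at h1
    unfold interp at h1 ⊢
    rw [hp] at h1 ⊢
    exact memH10_primitive (memLp_interpDeriv N x p) h1
  · filter_upwards [ae_restrict_mem measurableSet_Ioo] with t ht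
    rw [h.interp_eq p hj (Set.Ioo_subset_Icc_self ht), localInterp]
    ring

theorem sq_integral_le {G : ℝ → ℝ} {s t : ℝ} (hst : s ≤ t)
    (hG : IntervalIntegrable G volume s t)
    (hG2 : IntervalIntegrable (fun r => G r ^ 2) volume s t) :
    (∫ r in s..t, G r) ^ 2 ≤ (t - s) * ∫ r in s..t, G r ^ 2 := by
  rcases hst.eq_or_lt with rfl | hlt
  · simp
  set I := ∫ r in s..t, G r with hI
  set m := I / (t - s) with hm
  have h0 : 0 ≤ ∫ r in s..t, (G r - m) ^ 2 :=
    intervalIntegral.integral_nonneg hst fun r _ => sq_nonneg _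
  have e : (fun r => (G r - m) ^ 2) = fun r => (G r ^ 2 - 2 * m * G r) + m ^ 2 := by
    funext r; ring
  rw [e, intervalIntegral.integral_add (hG2.sub (hG.const_mul _))
    (intervalIntegrable_const), intervalIntegral.integral_sub hG2 (hG.const_mul _),
    intervalIntegral.integral_const_mul, intervalIntegral.integral_const, ← hI, smul_eq_mul] at h0
  have hpos := sub_pos.2 hlt
  have h1 : I = m * (t - s) := by rw [hm]; field_simp
  have h2 := mul_nonneg hpos.le h0
  have h3 : (t - s) * ((∫ r in s..t, G r ^ 2) - 2 * m * I + (t - s) * m ^ 2) =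
    (t - s) * (∫ r in s..t, G r ^ 2) - I ^ 2 := by rw [h1]; ring
  linarith

/-- `p` is continuous with modulus of continuity controlled by `∫ G`, where `G ∈ L²(I)`. -/
def ControlledBy (p G : ℝ → ℝ) : Prop :=
  ∀ s ∈ Set.Icc (-1 : ℝ) 1, ∀ t ∈ Set.Icc (-1 : ℝ) 1, s ≤ t → |p t - p s| ≤ ∫ r in s..t, G r

theorem ControlledBy.sq_le {p G : ℝ → ℝ} (h : ControlledBy p G)
    (hG : MemLp G 2 (volume.restrict dom)) {s t a b : ℝ} (hs : s ∈ Set.Icc a b)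
    (ht : t ∈ Set.Icc a b) (hst : s ≤ t) (ha : a ∈ Set.Icc (-1 : ℝ) 1)
    (hb : b ∈ Set.Icc (-1 : ℝ) 1) :
    (p t - p s) ^ 2 ≤ (t - s) * ∫ r in a..b, G r ^ 2 := by
  have i1 := intervalIntegrable_of_memLp_dom hG
  have i2 := integrableOn_dom_iff.1 hG.integrable_sq
  have hs' : s ∈ Set.Icc (-1 : ℝ) 1 := ⟨ha.1.trans hs.1, hs.2.trans hb.2⟩
  have ht' : t ∈ Set.Icc (-1 : ℝ) 1 := ⟨ha.1.trans ht.1, ht.2.trans hb.2⟩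
  have h1 := sq_integral_le hst (intervalIntegrable_mono_Icc i1 hs' ht')
    (intervalIntegrable_mono_Icc i2 hs' ht')
  have h2 : (p t - p s) ^ 2 ≤ (∫ r in s..t, G r) ^ 2 := by
    rw [← sq_abs (p t - p s)]
    exact pow_le_pow_left₀ (abs_nonneg _) (h s hs' t ht' hst) 2
  have h3 : ∫ r in s..t, G r ^ 2 ≤ ∫ r in a..b, G r ^ 2 :=
    intervalIntegral.integral_mono_interval hs.1 hst ht.2
      (Filter.Eventually.of_forall fun r => sq_nonneg _) (intervalIntegrable_mono_Icc i2 ha hb)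
  exact h2.trans (h1.trans (mul_le_mul_of_nonneg_left h3 (sub_nonneg.2 hst)))

theorem interpSlope_add (x : ℕ → ℝ) (p w : ℝ → ℝ) (j : ℕ) :
    interpSlope x (p + w) j = interpSlope x p j + interpSlope x w j := by
  simp only [interpSlope, Pi.add_apply]; ring

theorem localInterp_add (x : ℕ → ℝ) (p w : ℝ → ℝ) (j : ℕ) (t : ℝ) :
    localInterp x (p + w) j t = localInterp x p j t + localInterp x w j t := by
  simp only [localInterp, interpSlope_add, Pi.add_apply]; ring

theorem IsPartition.slope_sq_le {N : ℕ} {x : ℕ → ℝ} (h : IsPartition N x) {p G : ℝ → ℝ}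
    (hp : ControlledBy p G) (hG : MemLp G 2 (volume.restrict dom)) {j : ℕ} (hj : j < N) :
    (x (j + 1) - x j) * interpSlope x p j ^ 2 ≤ ∫ r in (x j)..(x (j + 1)), G r ^ 2 := by
  have hlt := h.lt j hj
  have h1 := hp.sq_le hG (s := x j) (t := x (j + 1)) ⟨le_rfl, hlt.le⟩ ⟨hlt.le, le_rfl⟩ hlt.le
    (h.mem_Icc hj.le) (h.mem_Icc (Nat.succ_le_of_lt hj))
  have hpos := sub_pos.2 hlt
  have e : (x (j + 1) - x j) * interpSlope x p j ^ 2 =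
      (p (x (j + 1)) - p (x j)) ^ 2 / (x (j + 1) - x j) := by
    unfold interpSlope; field_simp
  rw [e, div_le_iff₀ hpos]
  linarith

theorem IsPartition.localInterp_sq_le {N : ℕ} {x : ℕ → ℝ} (h : IsPartition N x) {p G : ℝ → ℝ}
    (hp : ControlledBy p G) (hG : MemLp G 2 (volume.restrict dom)) {j : ℕ} (hj : j < N) {t : ℝ}
    (ht : t ∈ Set.Icc (x j) (x (j + 1))) :
    (p t - localInterp x p j t) ^ 2 ≤
      4 * (x (j + 1) - x j) * ∫ r in (x j)..(x (j + 1)), G r ^ 2 := by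
  have hlt := h.lt j hj
  have h1 := hp.sq_le hG (s := x j) (t := t) ⟨le_rfl, hlt.le⟩ ht ht.1
    (h.mem_Icc hj.le) (h.mem_Icc (Nat.succ_le_of_lt hj))
  have h2 := h.slope_sq_le hp hG hj
  set J := ∫ r in (x j)..(x (j + 1)), G r ^ 2
  set σ := interpSlope x p j
  have hJ : 0 ≤ J := (mul_nonneg (sub_nonneg.2 hlt.le) (sq_nonneg σ)).trans h2
  have h3 : (t - x j) * J ≤ (x (j + 1) - x j) * J :=
    mul_le_mul_of_nonneg_right (by linarith [ht.2]) hJ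
  have h4 : (t - x j) ^ 2 * σ ^ 2 ≤ (x (j + 1) - x j) ^ 2 * σ ^ 2 :=
    mul_le_mul_of_nonneg_right
      (pow_le_pow_left₀ (by linarith [ht.1]) (by linarith [ht.2]) 2) (sq_nonneg _)
  have h5 := mul_le_mul_of_nonneg_left h2 (sub_nonneg.2 hlt.le)
  have e : p t - localInterp x p j t = (p t - p (x j)) - σ * (t - x j) := by
    simp only [localInterp]; ring
  rw [e]
  nlinarith [sq_nonneg ((p t - p (x j)) + σ * (t - x j))]

theorem IsPartition.interp_add {N : ℕ} {x : ℕ → ℝ} (h : IsPartition N x) (p w : ℝ → ℝ) {t : ℝ}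
    (ht : t ∈ dom) : interp N x (p + w) t = interp N x p t + interp N x w t := by
  obtain ⟨j, hj, htj⟩ := h.exists_mem ht
  have ht' := Set.Ioc_subset_Icc_self htj
  rw [h.interp_eq _ hj ht', h.interp_eq _ hj ht', h.interp_eq _ hj ht', localInterp_add]

theorem IsPartition.interpDeriv_add {N : ℕ} {x : ℕ → ℝ} (h : IsPartition N x) (p w : ℝ → ℝ)
    {t : ℝ} (ht : t ∈ dom) :
    interpDeriv N x (p + w) t = interpDeriv N x p t + interpDeriv N x w t := by
  obtain ⟨j, hj, htj⟩ := h.exists_mem ht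
  rw [h.interpDeriv_eq _ hj htj, h.interpDeriv_eq _ hj htj, h.interpDeriv_eq _ hj htj,
    interpSlope_add]

/-- The interpolation operator is stable in the `H¹` seminorm. -/
theorem IsPartition.integral_interpDeriv_sq_le {N : ℕ} {x : ℕ → ℝ} (h : IsPartition N x)
    {p G : ℝ → ℝ} (hp : ControlledBy p G) (hG : MemLp G 2 (volume.restrict dom)) :
    ∫ t in dom, interpDeriv N x p t ^ 2 ≤ ∫ t in dom, G t ^ 2 := by
  rw [← one_mul (∫ t in dom, G t ^ 2)]
  refine h.integral_le (memLp_interpDeriv N x p).integrable_sq hG.integrable_sq fun j hj => ?_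
  rw [one_mul, intervalIntegral.integral_congr_ae (g := fun _ => interpSlope x p j ^ 2)]
  · rw [intervalIntegral.integral_const, smul_eq_mul]
    exact h.slope_sq_le hp hG hj
  · filter_upwards with t ht
    rw [Set.uIoc_of_le (h.lt j hj).le] at ht
    rw [h.interpDeriv_eq p hj ht]

/-- First order `L²` error bound for the interpolant of a function in `H¹`. -/
theorem IsPartition.integral_interp_sq_le {N : ℕ} {x : ℕ → ℝ} (h : IsPartition N x)
    {p G : ℝ → ℝ} {δ : ℝ} (hp : ControlledBy p G) (hG : MemLp G 2 (volume.restrict dom))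
    (hpL : MemLp p 2 (volume.restrict dom)) (hδ : ∀ j < N, x (j + 1) - x j ≤ δ) :
    ∫ t in dom, (p t - interp N x p t) ^ 2 ≤ 4 * δ ^ 2 * ∫ t in dom, G t ^ 2 := by
  have hi := (hpL.sub (hasWeakDeriv_interp N x p).memLp).integrable_sq
  refine h.integral_le hi hG.integrable_sq fun j hj => ?_
  have hlt := h.lt j hj
  set J := ∫ r in (x j)..(x (j + 1)), G r ^ 2 with hJdef
  have hJ : 0 ≤ J := intervalIntegral.integral_nonneg hlt.le fun r _ => sq_nonneg _
  have hpos := sub_pos.2 hlt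
  have h1 : ∫ t in (x j)..(x (j + 1)), (p t - interp N x p t) ^ 2 ≤
      ∫ _ in (x j)..(x (j + 1)), 4 * (x (j + 1) - x j) * J := by
    apply intervalIntegral.integral_mono_on hlt.le _ intervalIntegrable_const
    · intro t ht
      rw [h.interp_eq p hj ht]
      exact h.localInterp_sq_le hp hG hj ht
    · exact intervalIntegrable_mono_Icc (integrableOn_dom_iff.1 hi) (h.mem_Icc hj.le)
        (h.mem_Icc (Nat.succ_le_of_lt hj))
  rw [intervalIntegral.integral_const, smul_eq_mul] at h1
  have h2 : (x (j + 1) - x j) ^ 2 ≤ δ ^ 2 := pow_le_pow_left₀ hpos.le (hδ j hj) 2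
  nlinarith [mul_le_mul_of_nonneg_right h2 hJ]

/-- A `C²` function with `|w'| ≤ D₁`, `|w''| ≤ D₂` on a mesh interval of length at most `h`. -/
theorem interp_error_of_deriv_le {x : ℕ → ℝ} {w w' w'' : ℝ → ℝ} {j : ℕ} {D₁ D₂ t : ℝ}
    (hlt : x j < x (j + 1)) (hw : ∀ t, HasDerivAt w (w' t) t)
    (hw' : ∀ t, HasDerivAt w' (w'' t) t)
    (hD₁ : ∀ s ∈ Set.Icc (x j) (x (j + 1)), |w' s| ≤ D₁)
    (hD₂ : ∀ s ∈ Set.Icc (x j) (x (j + 1)), |w'' s| ≤ D₂)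
    (ht : t ∈ Set.Icc (x j) (x (j + 1))) :
    |w' t - interpSlope x w j| ≤ D₂ * (x (j + 1) - x j) ∧
      |w t - localInterp x w j t| ≤ 2 * D₁ * (x (j + 1) - x j) := by
  obtain ⟨ξ, hξ, hs⟩ := exists_hasDerivAt_eq_slope w w' hlt
    (fun s _ => (hw s).continuousAt.continuousWithinAt) (fun s _ => hw s)
  have hs' : interpSlope x w j = w' ξ := hs.symm
  have hξ' := Set.Ioo_subset_Icc_self hξ
  have D₁0 : 0 ≤ D₁ := (abs_nonneg _).trans (hD₁ t ht)
  have D₂0 : 0 ≤ D₂ := (abs_nonneg _).trans (hD₂ t ht)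
  constructor
  · rw [hs']
    have := (convex_Icc (x j) (x (j + 1))).norm_image_sub_le_of_norm_hasDerivWithin_le
      (fun s _ => (hw' s).hasDerivWithinAt) hD₂ hξ' ht
    refine this.trans (mul_le_mul_of_nonneg_left ?_ D₂0)
    rw [Real.norm_eq_abs, abs_le]
    constructor <;> linarith [ht.1, ht.2, hξ'.1, hξ'.2]
  · have h1 := (convex_Icc (x j) (x (j + 1))).norm_image_sub_le_of_norm_hasDerivWithin_le
      (fun s _ => (hw s).hasDerivWithinAt) hD₁ (Set.left_mem_Icc.2 hlt.le) ht
    rw [Real.norm_eq_abs, Real.norm_eq_abs, abs_of_nonneg (sub_nonneg.2 ht.1)] at h1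
    have e : w t - localInterp x w j t = (w t - w (x j)) - w' ξ * (t - x j) := by
      simp only [localInterp, hs']; ring
    rw [e]
    have h2 : |w' ξ * (t - x j)| ≤ D₁ * (t - x j) := by
      rw [abs_mul, abs_of_nonneg (sub_nonneg.2 ht.1)]
      exact mul_le_mul_of_nonneg_right (hD₁ ξ hξ') (sub_nonneg.2 ht.1)
    have h3 : D₁ * (t - x j) ≤ D₁ * (x (j + 1) - x j) :=
      mul_le_mul_of_nonneg_left (by linarith [ht.2]) D₁0
    have := abs_sub (w t - w (x j)) (w' ξ * (t - x j))
    linarith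

theorem interp_error_of_le {x : ℕ → ℝ} {w w' : ℝ → ℝ} {j : ℕ} {D₀ D₁ t : ℝ}
    (hlt : x j < x (j + 1)) (hw : ∀ t, HasDerivAt w (w' t) t)
    (hD₀ : ∀ s ∈ Set.Icc (x j) (x (j + 1)), |w s| ≤ D₀)
    (hD₁ : ∀ s ∈ Set.Icc (x j) (x (j + 1)), |w' s| ≤ D₁)
    (ht : t ∈ Set.Icc (x j) (x (j + 1))) :
    |w' t - interpSlope x w j| ≤ 2 * D₁ ∧ |w t - localInterp x w j t| ≤ 2 * D₀ := by
  obtain ⟨ξ, hξ, hs⟩ := exists_hasDerivAt_eq_slope w w' hlt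
    (fun s _ => (hw s).continuousAt.continuousWithinAt) (fun s _ => hw s)
  have hs' : interpSlope x w j = w' ξ := hs.symm
  constructor
  · rw [hs']
    have := abs_sub (w' t) (w' ξ)
    linarith [hD₁ t ht, hD₁ ξ (Set.Ioo_subset_Icc_self hξ)]
  · have hpos := sub_pos.2 hlt
    set a := (t - x j) / (x (j + 1) - x j) with ha
    have ha0 : 0 ≤ a := div_nonneg (sub_nonneg.2 ht.1) hpos.le
    have ha1 : a ≤ 1 := (div_le_one hpos).2 (by linarith [ht.2])
    have e : localInterp x w j t = (1 - a) * w (x j) + a * w (x (j + 1)) := by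
      simp only [localInterp, interpSlope, ha]; field_simp; ring
    have h1 := abs_le.1 (hD₀ (x j) (Set.left_mem_Icc.2 hlt.le))
    have h2 := abs_le.1 (hD₀ (x (j + 1)) (Set.right_mem_Icc.2 hlt.le))
    have h3 := abs_le.1 (hD₀ t ht)
    rw [e, abs_le]
    constructor <;> nlinarith [mul_le_mul_of_nonneg_left h1.1 (sub_nonneg.2 ha1),
      mul_le_mul_of_nonneg_left h1.2 (sub_nonneg.2 ha1), mul_le_mul_of_nonneg_left h2.1 ha0,
      mul_le_mul_of_nonneg_left h2.2 ha0]

section Mesh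

theorem shishkinNode_left {θ ε : ℝ} {m i : ℕ} (hm : 0 < m) (hi : i ≤ m) :
    shishkinNode θ ε (4 * m) i = -1 + i / m * transition θ ε (4 * m) := by
  have hm' : (m : ℝ) ≠ 0 := by positivity
  rw [shishkinNode, if_pos (by omega)]
  push_cast
  field_simp

theorem shishkinNode_mid {θ ε : ℝ} {m i : ℕ} (hm : 0 < m) (hi : m ≤ i) (hi' : i ≤ 3 * m) :
    shishkinNode θ ε (4 * m) i =
      i / m * (1 - transition θ ε (4 * m)) - 2 + 2 * transition θ ε (4 * m) := by
  have hm' : (m : ℝ) ≠ 0 := by positivity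
  rcases hi.eq_or_lt with rfl | h
  · rw [shishkinNode_left hm le_rfl, div_self hm']; ring
  · rw [shishkinNode, if_neg (by omega), if_pos (by omega)]
    push_cast
    rw [mul_div_mul_left _ _ (by norm_num)]

theorem shishkinNode_right {θ ε : ℝ} {m i : ℕ} (hm : 0 < m) (hi : 3 * m ≤ i) :
    shishkinNode θ ε (4 * m) i = 1 - (4 - i / m) * transition θ ε (4 * m) := by
  have hm' : (m : ℝ) ≠ 0 := by positivity
  rcases hi.eq_or_lt with rfl | h
  · rw [shishkinNode_mid hm (by omega) le_rfl]
    push_cast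
    rw [mul_div_assoc, div_self hm']; ring
  · rw [shishkinNode, if_neg (by omega), if_neg (by omega)]
    push_cast
    rw [mul_div_mul_left _ _ (by norm_num)]

theorem shishkinNode_step {θ ε : ℝ} {m : ℕ} (hm : 0 < m) (j : ℕ) :
    shishkinNode θ ε (4 * m) (j + 1) - shishkinNode θ ε (4 * m) j =
        transition θ ε (4 * m) / m ∨
      (m ≤ j ∧ j + 1 ≤ 3 * m ∧
        shishkinNode θ ε (4 * m) (j + 1) - shishkinNode θ ε (4 * m) j =
          (1 - transition θ ε (4 * m)) / m) := by
  by_cases h1 : j + 1 ≤ m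
  · left
    rw [shishkinNode_left hm h1, shishkinNode_left hm (by omega)]
    push_cast; ring
  by_cases h2 : j + 1 ≤ 3 * m
  · right
    refine ⟨by omega, h2, ?_⟩
    rw [shishkinNode_mid hm (by omega) h2, shishkinNode_mid hm (by omega) (by omega)]
    push_cast; ring
  · left
    rw [shishkinNode_right hm (by omega), shishkinNode_right hm (by omega)]
    push_cast; ring

variable {θ ε : ℝ} {m : ℕ}

theorem transition_pos (hm : 0 < m) (hθ : 0 < θ) (hε : 0 < ε) : 0 < transition θ ε (4 * m) := by
  have : 0 < Real.log ((4 * m : ℕ) : ℝ) := Real.log_pos (by norm_cast; omega)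
  exact lt_min (by positivity) (by norm_num)

theorem transition_le : transition θ ε (4 * m) ≤ 1 / 4 := min_le_right _ _

theorem isPartition_shishkinNode (hm : 0 < m) (hθ : 0 < θ) (hε : 0 < ε) :
    IsPartition (4 * m) (shishkinNode θ ε (4 * m)) := by
  have hm' : (0 : ℝ) < m := by positivity
  refine ⟨?_, ?_, fun j hj => ?_⟩
  · rw [shishkinNode_left hm (Nat.zero_le _)]; simp
  · rw [shishkinNode_right hm (by omega)]
    push_cast
    rw [mul_div_assoc, div_self hm'.ne']; ring
  · rw [← sub_pos]
    rcases shishkinNode_step (θ := θ) (ε := ε) hm j with h | ⟨-, -, h⟩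
    · rw [h]; exact div_pos (transition_pos hm hθ hε) hm'
    · rw [h]
      exact div_pos (by linarith [transition_le (θ := θ) (ε := ε) (m := m)]) hm'

theorem shishkinNode_step_le (hm : 0 < m) (hθ : 0 < θ) (hε : 0 < ε) (j : ℕ) :
    shishkinNode θ ε (4 * m) (j + 1) - shishkinNode θ ε (4 * m) j ≤ 1 / m := by
  have h1 := transition_le (θ := θ) (ε := ε) (m := m)
  have h2 := transition_pos hm hθ hε
  rcases shishkinNode_step (θ := θ) (ε := ε) hm j with h | ⟨-, -, h⟩ <;> rw [h] <;> gcongr <;>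
    linarith

/-- Every interval of the Shishkin mesh is either of length `O(ε N⁻¹ log N)` or outside the
layers. -/
theorem shishkinNode_fine_or_coarse (hm : 0 < m) (hθ : 0 < θ) (hε : 0 < ε) {j : ℕ}
    (hj : j < 4 * m) :
    shishkinNode θ ε (4 * m) (j + 1) - shishkinNode θ ε (4 * m) j ≤
        4 * (θ * ε * Real.log ((4 * m : ℕ) : ℝ)) / m ∨
      (-1 + θ * ε * Real.log ((4 * m : ℕ) : ℝ) ≤ shishkinNode θ ε (4 * m) j ∧
        shishkinNode θ ε (4 * m) (j + 1) ≤ 1 - θ * ε * Real.log ((4 * m : ℕ) : ℝ)) := by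
  have hm' : (0 : ℝ) < m := by positivity
  have h1 := transition_le (θ := θ) (ε := ε) (m := m)
  have h2 := transition_pos hm hθ hε
  set τ := θ * ε * Real.log ((4 * m : ℕ) : ℝ) with hτ
  rcases le_total (1 / 4) τ with hc | hc
  · left
    refine (shishkinNode_step_le hm hθ hε j).trans ?_
    gcongr; linarith
  · have e : transition θ ε (4 * m) = τ := min_eq_left hc
    rcases shishkinNode_step (θ := θ) (ε := ε) hm j with h | ⟨hj1, hj2, h⟩
    · left
      rw [h, e]; rw [e] at h2; gcongr; linarith
    · right
      have hp := isPartition_shishkinNode hm hθ hε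
      constructor
      · have := hp.mono hj1 hj.le
        rw [shishkinNode_left hm le_rfl, e, div_self hm'.ne'] at this
        linarith
      · have := hp.mono hj2 (by omega)
        rw [shishkinNode_right hm le_rfl, e] at this
        push_cast at this
        rw [mul_div_assoc, div_self hm'.ne'] at this
        linarith

end Mesh

/-- An exponential layer function. -/
noncomputable def layer (A k d t : ℝ) : ℝ := A * Real.exp (k * t - d)

theorem hasDerivAt_layer (A k d t : ℝ) : HasDerivAt (layer A k d) (k * layer A k d t) t := by
  have h1 : HasDerivAt (fun t => k * t - d) (k * 1) t :=
    ((hasDerivAt_id t).const_mul k).sub_const d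
  have := (h1.exp).const_mul A
  exact this.congr_deriv (by rw [layer]; ring)

theorem abs_layer_le {A k d t r : ℝ} (h : k * t - d ≤ r) : |layer A k d t| ≤ |A| * Real.exp r := by
  rw [layer, abs_mul, Real.abs_exp]
  gcongr

/-- The sum of a left and a right boundary layer with decay rates `k₁` and `k₂`. -/
noncomputable def layers (A₁ A₂ k₁ k₂ : ℝ) : ℝ → ℝ := fun t =>
  layer A₁ (-k₁) k₁ t + layer A₂ k₂ k₂ t

noncomputable def layers' (A₁ A₂ k₁ k₂ : ℝ) : ℝ → ℝ := fun t =>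
  -k₁ * layer A₁ (-k₁) k₁ t + k₂ * layer A₂ k₂ k₂ t

noncomputable def layers'' (A₁ A₂ k₁ k₂ : ℝ) : ℝ → ℝ := fun t =>
  k₁ ^ 2 * layer A₁ (-k₁) k₁ t + k₂ ^ 2 * layer A₂ k₂ k₂ t

theorem hasDerivAt_layers (A₁ A₂ k₁ k₂ t : ℝ) :
    HasDerivAt (layers A₁ A₂ k₁ k₂) (layers' A₁ A₂ k₁ k₂ t) t :=
  (hasDerivAt_layer _ _ _ _).add (hasDerivAt_layer _ _ _ _)

theorem hasDerivAt_layers' (A₁ A₂ k₁ k₂ t : ℝ) :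
    HasDerivAt (layers' A₁ A₂ k₁ k₂) (layers'' A₁ A₂ k₁ k₂ t) t := by
  have h := ((hasDerivAt_layer A₁ (-k₁) k₁ t).const_mul (-k₁)).add
    ((hasDerivAt_layer A₂ k₂ k₂ t).const_mul k₂)
  exact h.congr_deriv (by simp only [layers'']; ring)

theorem contDiff_layer (A k d : ℝ) : ContDiff ℝ 1 (layer A k d) := by
  unfold layer
  fun_prop

theorem contDiff_layers' (A₁ A₂ k₁ k₂ : ℝ) : ContDiff ℝ 1 (layers' A₁ A₂ k₁ k₂) :=
  (contDiff_const.mul (contDiff_layer _ _ _)).add (contDiff_const.mul (contDiff_layer _ _ _))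

theorem layers_bounds {A₁ A₂ k₁ k₂ Q κ r t : ℝ} (h₁ : |A₁| ≤ Q) (h₂ : |A₂| ≤ Q)
    (hk₁ : 0 ≤ k₁) (hk₂ : 0 ≤ k₂) (hκ₁ : k₁ ≤ κ) (hκ₂ : k₂ ≤ κ)
    (ht₁ : -k₁ * t - k₁ ≤ r) (ht₂ : k₂ * t - k₂ ≤ r) :
    |layers A₁ A₂ k₁ k₂ t| ≤ 2 * Q * Real.exp r ∧
    |layers' A₁ A₂ k₁ k₂ t| ≤ 2 * Q * κ * Real.exp r ∧
    |layers'' A₁ A₂ k₁ k₂ t| ≤ 2 * Q * κ ^ 2 * Real.exp r := by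
  have e := Real.exp_pos r
  have hQ : 0 ≤ Q := (abs_nonneg _).trans h₁
  have b₁ : |layer A₁ (-k₁) k₁ t| ≤ Q * Real.exp r :=
    (abs_layer_le ht₁).trans (mul_le_mul_of_nonneg_right h₁ e.le)
  have b₂ : |layer A₂ k₂ k₂ t| ≤ Q * Real.exp r :=
    (abs_layer_le ht₂).trans (mul_le_mul_of_nonneg_right h₂ e.le)
  have comb : ∀ a₁ a₂ L : ℝ, |a₁| ≤ L → |a₂| ≤ L →
      |a₁ * layer A₁ (-k₁) k₁ t + a₂ * layer A₂ k₂ k₂ t| ≤ 2 * Q * L * Real.exp r := by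
    intro a₁ a₂ L ha₁ ha₂
    have hL : 0 ≤ L := (abs_nonneg _).trans ha₁
    refine (abs_add_le _ _).trans ?_
    rw [abs_mul, abs_mul]
    have c₁ := mul_le_mul ha₁ b₁ (abs_nonneg _) hL
    have c₂ := mul_le_mul ha₂ b₂ (abs_nonneg _) hL
    linarith
  refine ⟨?_, comb _ _ κ ?_ ?_, comb _ _ (κ ^ 2) ?_ ?_⟩
  · have := comb 1 1 1 (by simp) (by simp)
    simpa [layers] using this
  · rwa [abs_neg, abs_of_nonneg hk₁]
  · rwa [abs_of_nonneg hk₂]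
  · rw [abs_of_nonneg (sq_nonneg _)]; gcongr
  · rw [abs_of_nonneg (sq_nonneg _)]; gcongr

/-- The interpolation error of the boundary layers on the Shishkin mesh. -/
theorem layers_interp_error {A₁ A₂ β₁ β₂ Q c κ ε θ : ℝ} {m : ℕ} (hm : 0 < m)
    (hε : 0 < ε) (hθ : 0 < θ) (hc : 0 < c) (hcθ : 1 ≤ c * θ) (h₁ : |A₁| ≤ Q) (h₂ : |A₂| ≤ Q)
    (hβ₁ : c ≤ β₁) (hβ₂ : c ≤ β₂) (hκ₁ : β₁ ≤ κ) (hκ₂ : β₂ ≤ κ) {t : ℝ} (ht : t ∈ dom) :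
    |layers A₁ A₂ (β₁ / ε) (β₂ / ε) t -
        interp (4 * m) (shishkinNode θ ε (4 * m)) (layers A₁ A₂ (β₁ / ε) (β₂ / ε)) t| ≤
      (64 * Q * (κ + κ ^ 2) * θ + 4 * Q * (1 + κ)) *
        (((4 * m : ℕ) : ℝ)⁻¹ * Real.log ((4 * m : ℕ) : ℝ)) ∧
    ε * |layers' A₁ A₂ (β₁ / ε) (β₂ / ε) t -
        interpDeriv (4 * m) (shishkinNode θ ε (4 * m)) (layers A₁ A₂ (β₁ / ε) (β₂ / ε)) t| ≤
      (64 * Q * (κ + κ ^ 2) * θ + 4 * Q * (1 + κ)) *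
        (((4 * m : ℕ) : ℝ)⁻¹ * Real.log ((4 * m : ℕ) : ℝ)) := by
  have hp := isPartition_shishkinNode hm hθ hε
  obtain ⟨j, hj, htj⟩ := hp.exists_mem ht
  have ht' := Set.Ioc_subset_Icc_self htj
  rw [hp.interp_eq _ hj ht', hp.interpDeriv_eq _ hj htj]
  have hm' : (0 : ℝ) < m := by positivity
  have hN : (0 : ℝ) < ((4 * m : ℕ) : ℝ) := by positivity
  have hκ : 0 < κ := hc.trans_le (hβ₁.trans hκ₁)
  have hQ : 0 ≤ Q := (abs_nonneg _).trans h₁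
  have hβ₁0 := hc.trans_le hβ₁
  have hβ₂0 := hc.trans_le hβ₂
  have hlog : 1 ≤ Real.log ((4 * m : ℕ) : ℝ) := by
    rw [Real.le_log_iff_exp_le hN]
    have h4 : (4 : ℝ) ≤ ((4 * m : ℕ) : ℝ) := by norm_cast; omega
    linarith [Real.exp_one_lt_d9]
  have bounds : ∀ r s : ℝ, -(β₁ / ε) * s - β₁ / ε ≤ r → β₂ / ε * s - β₂ / ε ≤ r →
      |layers A₁ A₂ (β₁ / ε) (β₂ / ε) s| ≤ 2 * Q * Real.exp r ∧
      |layers' A₁ A₂ (β₁ / ε) (β₂ / ε) s| ≤ 2 * Q * (κ / ε) * Real.exp r ∧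
      |layers'' A₁ A₂ (β₁ / ε) (β₂ / ε) s| ≤ 2 * Q * (κ / ε) ^ 2 * Real.exp r := fun r s e₁ e₂ =>
    layers_bounds h₁ h₂ (div_pos hβ₁0 hε).le (div_pos hβ₂0 hε).le (by gcongr) (by gcongr) e₁ e₂
  set y := shishkinNode θ ε (4 * m)
  set w := layers A₁ A₂ (β₁ / ε) (β₂ / ε)
  set w' := layers' A₁ A₂ (β₁ / ε) (β₂ / ε)
  set l := Real.log ((4 * m : ℕ) : ℝ) with hl
  set n := ((4 * m : ℕ) : ℝ) with hn
  have hlt := hp.lt j hj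
  have X0 : 0 ≤ 64 * Q * θ * (n⁻¹ * l) := by positivity
  have Y0 : 0 ≤ 4 * Q * (n⁻¹ * l) := by positivity
  rcases shishkinNode_fine_or_coarse hm hθ hε hj with hfine | ⟨hco₁, hco₂⟩
  · have bd : ∀ s ∈ Set.Icc (y j) (y (j + 1)), |w' s| ≤ 2 * Q * (κ / ε) ∧
        |layers'' A₁ A₂ (β₁ / ε) (β₂ / ε) s| ≤ 2 * Q * (κ / ε) ^ 2 := by
      intro s hs
      have hs' := hp.mem_Icc_of_mem hj hs
      have := bounds 0 s
        (by nlinarith [mul_nonneg (div_pos hβ₁0 hε).le (by linarith [hs'.1] : 0 ≤ s + 1)])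
        (by nlinarith [mul_nonneg (div_pos hβ₂0 hε).le (by linarith [hs'.2] : 0 ≤ 1 - s)])
      rw [Real.exp_zero, mul_one, mul_one, mul_one] at this
      exact this.2
    obtain ⟨e₁, e₂⟩ := interp_error_of_deriv_le hlt (hasDerivAt_layers _ _ _ _)
      (hasDerivAt_layers' _ _ _ _) (fun s hs => (bd s hs).1) (fun s hs => (bd s hs).2) ht'
    have hstep : y (j + 1) - y j ≤ 16 * (θ * ε) * (n⁻¹ * l) := by
      refine hfine.trans (le_of_eq ?_)
      have hm4 : (m : ℝ) = n / 4 := by rw [hn]; push_cast; ring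
      change 4 * (θ * ε * l) / (m : ℝ) = _
      rw [hm4]; field_simp; norm_num
    constructor
    · refine e₂.trans ((mul_le_mul_of_nonneg_left hstep (by positivity)).trans ?_)
      have e : 2 * (2 * Q * (κ / ε)) * (16 * (θ * ε) * (n⁻¹ * l)) =
          κ * (64 * Q * θ * (n⁻¹ * l)) := by field_simp; ring
      rw [e]
      nlinarith [mul_nonneg hκ.le Y0, mul_nonneg (sq_nonneg κ) X0]
    · have e₃ := mul_le_mul_of_nonneg_left
        (e₁.trans (mul_le_mul_of_nonneg_left hstep (by positivity))) hε.le
      refine e₃.trans ?_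
      have e : ε * (2 * Q * (κ / ε) ^ 2 * (16 * (θ * ε) * (n⁻¹ * l))) =
          κ ^ 2 / 2 * (64 * Q * θ * (n⁻¹ * l)) := by field_simp; ring
      rw [e]
      nlinarith [mul_nonneg hκ.le Y0, mul_nonneg (sq_nonneg κ) X0, mul_nonneg hκ.le X0]
  · have hexp : Real.exp (-l) = n⁻¹ := by rw [Real.exp_neg, hl, Real.exp_log hN]
    have bd : ∀ s ∈ Set.Icc (y j) (y (j + 1)), |w s| ≤ 2 * Q * n⁻¹ ∧
        |w' s| ≤ 2 * Q * (κ / ε) * n⁻¹ := by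
      intro s hs
      have dec : ∀ β z, c ≤ β → θ * ε * l ≤ z → l ≤ β / ε * z := by
        intro β z hβ hz
        have h3 : β / ε * (θ * ε * l) ≤ β / ε * z :=
          mul_le_mul_of_nonneg_left hz (div_nonneg (hc.le.trans hβ) hε.le)
        have h4 : β / ε * (θ * ε * l) = β * θ * l := by field_simp
        have h5 : 1 ≤ β * θ := hcθ.trans (mul_le_mul_of_nonneg_right hβ hθ.le)
        nlinarith
      have := bounds (-l) s
        (by linarith [dec β₁ (1 + s) hβ₁ (by linarith [hs.1])])
        (by linarith [dec β₂ (1 - s) hβ₂ (by linarith [hs.2])])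
      rw [hexp] at this
      exact ⟨this.1, this.2.1⟩
    obtain ⟨e₁, e₂⟩ := interp_error_of_le hlt (hasDerivAt_layers _ _ _ _)
      (fun s hs => (bd s hs).1) (fun s hs => (bd s hs).2) ht'
    have hnl : n⁻¹ ≤ n⁻¹ * l := le_mul_of_one_le_right (inv_pos.2 hN).le hlog
    have hZ : 4 * Q * n⁻¹ ≤ 4 * Q * (n⁻¹ * l) := mul_le_mul_of_nonneg_left hnl (by positivity)
    constructor
    · refine e₂.trans ?_
      nlinarith [mul_nonneg hκ.le Y0, mul_nonneg (sq_nonneg κ) X0, mul_nonneg hκ.le X0]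
    · have e₃ := mul_le_mul_of_nonneg_left e₁ hε.le
      refine e₃.trans ?_
      have e : ε * (2 * (2 * Q * (κ / ε) * n⁻¹)) = κ * (4 * Q * n⁻¹) := by field_simp; ring
      rw [e]
      nlinarith [mul_le_mul_of_nonneg_left hZ hκ.le, mul_nonneg (sq_nonneg κ) X0,
        mul_nonneg hκ.le X0]

theorem integral_mul_exp_le {k : ℝ} (hk : 0 < k) :
    ∫ s in (0 : ℝ)..2, s * Real.exp (-(2 * k) * s) ≤ 1 / (4 * k ^ 2) := by
  have hd : ∀ s ∈ Set.uIcc (0 : ℝ) 2,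
      HasDerivAt (fun s => -(s / (2 * k) + 1 / (4 * k ^ 2)) * Real.exp (-(2 * k) * s))
      (s * Real.exp (-(2 * k) * s)) s := by
    intro s _
    have h1 : HasDerivAt (fun s => -(2 * k) * s) (-(2 * k) * 1) s :=
      (hasDerivAt_id s).const_mul _
    have h2 : HasDerivAt (fun s => -(s / (2 * k) + 1 / (4 * k ^ 2))) (-(1 / (2 * k))) s :=
      (((hasDerivAt_id s).div_const _).add_const _).neg
    exact (h2.mul h1.exp).congr_deriv (by field_simp; ring)
  rw [intervalIntegral.integral_eq_sub_of_hasDerivAt hd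
    (Continuous.intervalIntegrable (by fun_prop) _ _)]
  have : 0 ≤ (2 / (2 * k) + 1 / (4 * k ^ 2)) * Real.exp (-(2 * k) * 2) := by positivity
  simp only [zero_div, zero_add, mul_zero, Real.exp_zero, mul_one]
  linarith

theorem integral_left_layer_le {k : ℝ} (hk : 0 < k) :
    ∫ t in dom, (1 + t) * Real.exp (-(2 * k) * (1 + t)) ≤ 1 / (4 * k ^ 2) := by
  rw [integral_dom]
  have := intervalIntegral.integral_comp_add_left
    (a := -1) (b := 1) (fun s => s * Real.exp (-(2 * k) * s)) 1
  rw [this]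
  norm_num only
  simpa using integral_mul_exp_le hk

theorem integral_right_layer_le {k : ℝ} (hk : 0 < k) :
    ∫ t in dom, (1 - t) * Real.exp (-(2 * k) * (1 - t)) ≤ 1 / (4 * k ^ 2) := by
  rw [integral_dom]
  have := intervalIntegral.integral_comp_sub_left
    (a := -1) (b := 1) (fun s => s * Real.exp (-(2 * k) * s)) 1
  rw [this]
  norm_num only
  simpa using integral_mul_exp_le hk

theorem controlledBy_primitive {g : ℝ → ℝ} (hg : MemLp g 2 (volume.restrict dom)) (c : ℝ) :
    ControlledBy (primitive c g) (fun t => |g t|) := by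
  intro s hs t ht hst
  rw [primitive_sub (intervalIntegrable_of_memLp_dom hg) c hs ht]
  exact intervalIntegral.abs_integral_le_integral_abs hst

theorem intervalIntegrable_of_memLp_of_mem {G : ℝ → ℝ} (hG : MemLp G 2 (volume.restrict dom))
    {s t : ℝ} (hs : s ∈ Set.Icc (-1 : ℝ) 1) (ht : t ∈ Set.Icc (-1 : ℝ) 1) :
    IntervalIntegrable G volume s t :=
  intervalIntegrable_mono_Icc (intervalIntegrable_of_memLp_dom hG) hs ht

theorem ControlledBy.div {F B g₁ g₂ : ℝ → ℝ} {c M : ℝ} (hF : ControlledBy F g₁)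
    (hB : ControlledBy B g₂) (hg₁ : MemLp g₁ 2 (volume.restrict dom))
    (hg₂ : MemLp g₂ 2 (volume.restrict dom)) (hc : 0 < c)
    (hBc : ∀ t ∈ Set.Icc (-1 : ℝ) 1, c ≤ B t) (hBM : ∀ t ∈ Set.Icc (-1 : ℝ) 1, |B t| ≤ M)
    (hFM : ∀ t ∈ Set.Icc (-1 : ℝ) 1, |F t| ≤ M) :
    ControlledBy (fun t => F t / B t) (fun t => M / c ^ 2 * (g₁ t + g₂ t)) := by
  intro s hs t ht hst
  rw [intervalIntegral.integral_const_mul, intervalIntegral.integral_add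
    (intervalIntegrable_of_memLp_of_mem hg₁ hs ht) (intervalIntegrable_of_memLp_of_mem hg₂ hs ht)]
  have h1 := hF s hs t ht hst
  have h2 := hB s hs t ht hst
  have b1 := hBc s hs
  have b2 := hBc t ht
  have p1 : 0 < B s := hc.trans_le b1
  have p2 : 0 < B t := hc.trans_le b2
  have hM : 0 ≤ M := (abs_nonneg _).trans (hFM s hs)
  have e : F t / B t - F s / B s = ((F t - F s) * B s - F s * (B t - B s)) / (B t * B s) := by
    field_simp; ring
  have h3 : |(F t - F s) * B s - F s * (B t - B s)| ≤ M * (|F t - F s| + |B t - B s|) := by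
    refine (abs_sub _ _).trans ?_
    rw [abs_mul, abs_mul]
    have := mul_le_mul_of_nonneg_left (hBM s hs) (abs_nonneg (F t - F s))
    have := mul_le_mul_of_nonneg_right (hFM s hs) (abs_nonneg (B t - B s))
    linarith
  rw [e, abs_div, abs_of_pos (mul_pos p2 p1), div_mul_eq_mul_div]
  have h4 : M * (|F t - F s| + |B t - B s|) ≤
      M * ((∫ r in s..t, g₁ r) + ∫ r in s..t, g₂ r) := by gcongr
  have h5 : c ^ 2 ≤ B t * B s := by nlinarith
  exact div_le_div₀ ((abs_nonneg _).trans (h3.trans h4)) (h3.trans h4) (by positivity) h5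

theorem ControlledBy.add_affine {p G : ℝ → ℝ} (h : ControlledBy p G)
    (hG : MemLp G 2 (volume.restrict dom)) {a b K : ℝ} (hb : |b| ≤ K) :
    ControlledBy (fun t => p t + (a + b * t)) (fun t => G t + K) := by
  intro s hs t ht hst
  rw [intervalIntegral.integral_add (intervalIntegrable_of_memLp_of_mem hG hs ht)
    intervalIntegrable_const, intervalIntegral.integral_const, smul_eq_mul]
  have e : p t + (a + b * t) - (p s + (a + b * s)) = (p t - p s) + b * (t - s) := by ring
  rw [e]
  refine (abs_add_le _ _).trans (add_le_add (h s hs t ht hst) ?_)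
  rw [abs_mul, abs_of_nonneg (sub_nonneg.2 hst), mul_comm]
  exact mul_le_mul_of_nonneg_left hb (sub_nonneg.2 hst)

theorem integrableOn_dom_of_continuous {p : ℝ → ℝ} (hp : Continuous p) : IntegrableOn p dom :=
  integrableOn_dom_iff.2 (hp.intervalIntegrable _ _)

theorem left_layer_residual_le {B G : ℝ → ℝ} (hB : ControlledBy B G)
    (hG : MemLp G 2 (volume.restrict dom)) {A k Q t : ℝ} (hA : |A| ≤ Q)
    (ht : t ∈ Set.Icc (-1 : ℝ) 1) :
    ((B (-1) - B t) * layer A (-k) k t) ^ 2 ≤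
      (∫ r in (-1 : ℝ)..1, G r ^ 2) * Q ^ 2 * ((1 + t) * Real.exp (-(2 * k) * (1 + t))) := by
  have h := hB.sq_le hG (s := -1) (t := t) (a := -1) (b := 1) (by norm_num) ht ht.1 (by norm_num)
    (by norm_num)
  have e : (layer A (-k) k t) ^ 2 = A ^ 2 * Real.exp (-(2 * k) * (1 + t)) := by
    rw [layer, mul_pow, ← Real.exp_nat_mul]
    congr 2
    push_cast; ring
  have hA2 : A ^ 2 ≤ Q ^ 2 := by
    rw [← sq_abs A]; exact pow_le_pow_left₀ (abs_nonneg _) hA 2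
  rw [mul_pow, e]
  have h1 : (B (-1) - B t) ^ 2 ≤ (1 + t) * ∫ r in (-1 : ℝ)..1, G r ^ 2 := by
    calc _ = (B t - B (-1)) ^ 2 := by ring
      _ ≤ _ := h
      _ = _ := by ring
  calc _ ≤ ((1 + t) * ∫ r in (-1 : ℝ)..1, G r ^ 2) *
        (Q ^ 2 * Real.exp (-(2 * k) * (1 + t))) := by
        apply mul_le_mul h1 _ (by positivity) ((sq_nonneg _).trans h1)
        gcongr
    _ = _ := by ring

theorem right_layer_residual_le {B G : ℝ → ℝ} (hB : ControlledBy B G)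
    (hG : MemLp G 2 (volume.restrict dom)) {A k Q t : ℝ} (hA : |A| ≤ Q)
    (ht : t ∈ Set.Icc (-1 : ℝ) 1) :
    ((B 1 - B t) * layer A k k t) ^ 2 ≤
      (∫ r in (-1 : ℝ)..1, G r ^ 2) * Q ^ 2 * ((1 - t) * Real.exp (-(2 * k) * (1 - t))) := by
  have h1 := hB.sq_le hG (s := t) (t := 1) (a := -1) (b := 1) ht (by norm_num) ht.2 (by norm_num)
    (by norm_num)
  have e : (layer A k k t) ^ 2 = A ^ 2 * Real.exp (-(2 * k) * (1 - t)) := by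
    rw [layer, mul_pow, ← Real.exp_nat_mul]
    congr 2
    push_cast; ring
  have hA2 : A ^ 2 ≤ Q ^ 2 := by
    rw [← sq_abs A]; exact pow_le_pow_left₀ (abs_nonneg _) hA 2
  rw [mul_pow, e]
  calc _ ≤ ((1 - t) * ∫ r in (-1 : ℝ)..1, G r ^ 2) *
        (Q ^ 2 * Real.exp (-(2 * k) * (1 - t))) := by
        apply mul_le_mul h1 _ (by positivity) ((sq_nonneg _).trans h1)
        gcongr
    _ = _ := by ring

theorem sq_sum_five_div_le {a b c d e v₁ v₂ v₃ v₄ v₅ k : ℝ} (hk : 0 < k) (h₁ : a ^ 2 ≤ v₁)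
    (h₂ : b ^ 2 ≤ v₂) (h₃ : c ^ 2 ≤ v₃) (h₄ : d ^ 2 ≤ v₄) (h₅ : e ^ 2 ≤ v₅) :
    (a + b + c + d + e) ^ 2 / k ≤ 5 * (v₁ + v₂ + v₃ + v₄ + v₅) / k := by
  apply div_le_div_of_nonneg_right _ hk.le
  nlinarith [sq_nonneg (a - b), sq_nonneg (a - c), sq_nonneg (a - d), sq_nonneg (a - e),
    sq_nonneg (b - c), sq_nonneg (b - d), sq_nonneg (b - e), sq_nonneg (c - d),
    sq_nonneg (c - e), sq_nonneg (d - e)]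

theorem mul_sq_sub_add_le {ε a d e v : ℝ} (h : ε ^ 2 * (a - e) ^ 2 ≤ v) :
    ε ^ 2 * (a - (d + e)) ^ 2 ≤ 2 * v + 2 * ε ^ 2 * d ^ 2 := by
  nlinarith [mul_nonneg (sq_nonneg ε) (sq_nonneg (a - e + d))]

theorem exp_neg_le_div {β c ε : ℝ} (hε : 0 < ε) (hc : 0 < c) (hβ : c ≤ β) :
    Real.exp (-(β / ε) - β / ε) ≤ ε / (2 * c) := by
  have h1 : 2 * c / ε ≤ 2 * β / ε := by gcongr
  have h2 : Real.exp (-(β / ε) - β / ε) = (Real.exp (2 * β / ε))⁻¹ := by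
    rw [← Real.exp_neg]; congr 1; ring
  have h3 : 2 * c / ε ≤ Real.exp (2 * β / ε) := by
    linarith [Real.add_one_le_exp (2 * β / ε)]
  rw [h2, show ε / (2 * c) = (2 * c / ε)⁻¹ by rw [inv_div]]
  exact inv_anti₀ (by positivity) h3

theorem integral_dom_linear_combination {p L R d : ℝ → ℝ} (hp : IntegrableOn p dom)
    (hL : IntegrableOn L dom) (hR : IntegrableOn R dom) (hd : IntegrableOn d dom)
    (a₀ a₁ a₂ a₃ : ℝ) :
    IntegrableOn (fun t => a₀ + a₁ * p t + a₂ * (L t + R t) + a₃ * d t) dom ∧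
    ∫ t in dom, (a₀ + a₁ * p t + a₂ * (L t + R t) + a₃ * d t) =
      2 * a₀ + a₁ * (∫ t in dom, p t) + a₂ * ((∫ t in dom, L t) + ∫ t in dom, R t) +
        a₃ * ∫ t in dom, d t := by
  have h0 : IntegrableOn (fun _ : ℝ => a₀) dom := integrable_const _
  have i1 : IntegrableOn (fun t => a₀ + a₁ * p t) dom := h0.add (hp.const_mul a₁)
  have i2 : IntegrableOn (fun t => a₂ * (L t + R t)) dom := (hL.add hR).const_mul a₂
  have i12 : IntegrableOn (fun t => a₀ + a₁ * p t + a₂ * (L t + R t)) dom := i1.add i2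
  refine ⟨i12.add (hd.const_mul a₃), ?_⟩
  rw [integral_add i12 (hd.const_mul a₃), integral_add i1 i2, integral_add h0 (hp.const_mul a₁),
    integral_const_mul, integral_const_mul, integral_const_mul, integral_add hL hR,
    setIntegral_const]
  congr 3
  simp [dom]
  norm_num

set_option maxHeartbeats 400000 in
/-- For reduced problem data in `H¹`, the interpolant of the asymptotic expansion (reduced solution
plus boundary layers plus a linear correction) has a small residual. -/
theorem exists_interp_residual_le {F B gF gB : ℝ → ℝ} {bmin M : ℝ} (hbmin : 0 < bmin)
    (hFc : ContinuousOn F (Set.Icc (-1) 1)) (hBc : ContinuousOn B (Set.Icc (-1) 1))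
    (hF : ControlledBy F gF) (hB : ControlledBy B gB)
    (hgF : MemLp gF 2 (volume.restrict dom)) (hgB : MemLp gB 2 (volume.restrict dom))
    (hBmin : ∀ t ∈ Set.Icc (-1 : ℝ) 1, bmin ≤ B t) (hBM : ∀ t ∈ Set.Icc (-1 : ℝ) 1, |B t| ≤ M)
    (hFM : ∀ t ∈ Set.Icc (-1 : ℝ) 1, |F t| ≤ M) :
    ∃ C : ℝ, 0 < C ∧ ∀ ε : ℝ, 0 < ε → ∀ m : ℕ, 0 < m → ε ≤ ((4 * m : ℕ) : ℝ)⁻¹ →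
      ∃ P ψ : ℝ → ℝ, P (-1) = 0 ∧ P 1 = 0 ∧ ContDiff ℝ 1 ψ ∧
        ∫ t in dom, ((F t - B t * interp (4 * m) (shishkinMesh bmin ε (4 * m)) P t +
            ε ^ 2 * deriv ψ t) ^ 2 / bmin +
          ε ^ 2 * (ψ t - interpDeriv (4 * m) (shishkinMesh bmin ε (4 * m)) P t) ^ 2) ≤
        C ^ 2 * (((4 * m : ℕ) : ℝ)⁻¹ * Real.log ((4 * m : ℕ) : ℝ)) ^ 2 := by
  have mL : (-1 : ℝ) ∈ Set.Icc (-1 : ℝ) 1 := by norm_num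
  have mR : (1 : ℝ) ∈ Set.Icc (-1 : ℝ) 1 := by norm_num
  have hMpos : 0 < M := hbmin.trans_le ((hBmin _ mL).trans ((le_abs_self _).trans (hBM _ mL)))
  set c := Real.sqrt bmin with hc
  set κ := Real.sqrt M with hκ
  set Q := M / bmin with hQ
  set θ := 2 * betaStar bmin with hθ
  have hc0 : 0 < c := Real.sqrt_pos.2 hbmin
  have hc2 : c ^ 2 = bmin := Real.sq_sqrt hbmin.le
  have hQ0 : 0 < Q := div_pos hMpos hbmin
  have hθc : c * θ = 4 := by
    rw [hθ, betaStar, ← hc]; field_simp; norm_num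
  have hθ0 : 0 < θ := by rw [hθ, betaStar]; positivity
  set q : ℝ → ℝ := fun t => F t / B t with hq
  have hqQ : ∀ t ∈ Set.Icc (-1 : ℝ) 1, |q t| ≤ Q := by
    intro t ht
    have h1 := hBmin t ht
    rw [hq]
    simp only
    rw [abs_div, abs_of_pos (hbmin.trans_le h1)]
    exact div_le_div₀ hMpos.le (hFM t ht) hbmin h1
  set β₁ := Real.sqrt (B (-1)) with hβ₁
  set β₂ := Real.sqrt (B 1) with hβ₂
  have hB1pos : 0 < B (-1) := hbmin.trans_le (hBmin _ mL)
  have hB2pos : 0 < B 1 := hbmin.trans_le (hBmin _ mR)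
  have hcβ₁ : c ≤ β₁ := Real.sqrt_le_sqrt (hBmin _ mL)
  have hcβ₂ : c ≤ β₂ := Real.sqrt_le_sqrt (hBmin _ mR)
  have hβ₁κ : β₁ ≤ κ := Real.sqrt_le_sqrt ((le_abs_self _).trans (hBM _ mL))
  have hβ₂κ : β₂ ≤ κ := Real.sqrt_le_sqrt ((le_abs_self _).trans (hBM _ mR))
  set G : ℝ → ℝ := fun t => M / bmin ^ 2 * (gF t + gB t) with hG
  have hGL : MemLp G 2 (volume.restrict dom) := (hgF.add hgB).const_mul _
  have hqG : ControlledBy q G := hF.div hB hgF hgB hbmin hBmin hBM hFM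
  have hGQ : MemLp (fun t => G t + Q) 2 (volume.restrict dom) := hGL.add (memLp_const Q)
  set S := ∫ t in dom, (G t + Q) ^ 2 with hS
  have hS0 : 0 ≤ S := integral_nonneg fun t => sq_nonneg _
  set T := ∫ r in (-1 : ℝ)..1, gB r ^ 2 with hT
  have hT0 : 0 ≤ T := intervalIntegral.integral_nonneg (by norm_num) fun t _ => sq_nonneg _
  set K := 64 * Q * (κ + κ ^ 2) * θ + 4 * Q * (1 + κ) with hK
  set a₀ := 5 / bmin * M ^ 2 * (Q / (2 * c)) ^ 2 + 5 / bmin * M ^ 2 * K ^ 2 + 2 * K ^ 2 with ha₀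
  set a₁ := 5 / bmin * M ^ 2 with ha₁
  set a₂ := 5 / bmin * (T * Q ^ 2) with ha₂
  have ha₀0 : 0 ≤ a₀ := by positivity
  have ha₁0 : 0 ≤ a₁ := by positivity
  have ha₂0 : 0 ≤ a₂ := by positivity
  set C2 := 1 + 2 * a₀ + 64 * a₁ * S + a₂ / (2 * bmin) + 2 * S with hC2
  have hC2pos : 0 < C2 := by positivity
  refine ⟨Real.sqrt C2, Real.sqrt_pos.2 hC2pos, fun ε hε m hm hεm => ?_⟩
  rw [Real.sq_sqrt hC2pos.le]
  change ∃ P ψ : ℝ → ℝ, P (-1) = 0 ∧ P 1 = 0 ∧ ContDiff ℝ 1 ψ ∧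
    ∫ t in dom, ((F t - B t * interp (4 * m) (shishkinNode θ ε (4 * m)) P t +
      ε ^ 2 * deriv ψ t) ^ 2 / bmin +
      ε ^ 2 * (ψ t - interpDeriv (4 * m) (shishkinNode θ ε (4 * m)) P t) ^ 2) ≤ _
  have hp := isPartition_shishkinNode hm hθ0 hε
  set n := ((4 * m : ℕ) : ℝ) with hn
  have hm' : (0 : ℝ) < m := by positivity
  have hn4 : n = 4 * m := by rw [hn]; push_cast; ring
  have hn0 : 0 < n := by rw [hn4]; positivity
  have hlog : 1 ≤ Real.log n := by
    rw [Real.le_log_iff_exp_le hn0]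
    have h4 : (4 : ℝ) ≤ n := by rw [hn]; norm_cast; omega
    linarith [Real.exp_one_lt_d9]
  set Λ := n⁻¹ * Real.log n with hΛ
  have hnΛ : n⁻¹ ≤ Λ := le_mul_of_one_le_right (inv_pos.2 hn0).le hlog
  have hΛ0 : 0 < Λ := (inv_pos.2 hn0).trans_le hnΛ
  have hεΛ : ε ≤ Λ := hεm.trans hnΛ
  set E₁ := Real.exp (-(β₁ / ε) - β₁ / ε) with hE₁
  set E₂ := Real.exp (-(β₂ / ε) - β₂ / ε) with hE₂
  have E₁le : E₁ ≤ ε / (2 * c) := exp_neg_le_div hε hc0 hcβ₁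
  have E₂le : E₂ ≤ ε / (2 * c) := exp_neg_le_div hε hc0 hcβ₂
  have E₁one : E₁ ≤ 1 := Real.exp_le_one_iff.2 (by
    have : 0 ≤ β₁ / ε := by positivity
    linarith)
  have E₂one : E₂ ≤ 1 := Real.exp_le_one_iff.2 (by
    have : 0 ≤ β₂ / ε := by positivity
    linarith)
  have E₁0 : 0 ≤ E₁ := (Real.exp_pos _).le
  have E₂0 : 0 ≤ E₂ := (Real.exp_pos _).le
  set ℓ₁ := q 1 * E₂ with hℓ₁
  set ℓ₂ := q (-1) * E₁ with hℓ₂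
  have absmul : ∀ x E δ : ℝ, |x| ≤ Q → 0 ≤ E → E ≤ δ → |x * E| ≤ Q * δ := by
    intro x E δ h1 h2 h3
    rw [abs_mul, abs_of_nonneg h2]
    exact mul_le_mul h1 h3 h2 hQ0.le
  have l₁ := abs_le.1 (absmul _ _ _ (hqQ 1 mR) E₂0 E₂le)
  have l₂ := abs_le.1 (absmul _ _ _ (hqQ (-1) mL) E₁0 E₁le)
  have l₁' := abs_le.1 (absmul _ _ _ (hqQ 1 mR) E₂0 E₂one)
  have l₂' := abs_le.1 (absmul _ _ _ (hqQ (-1) mL) E₁0 E₁one)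
  set ℓ : ℝ → ℝ := fun t => (ℓ₁ + ℓ₂) / 2 + (ℓ₂ - ℓ₁) / 2 * t with hℓ
  have hℓle : ∀ t ∈ Set.Icc (-1 : ℝ) 1, ℓ t ^ 2 ≤ (Q / (2 * c)) ^ 2 * Λ ^ 2 := by
    intro t ht
    have h1 : |ℓ t| ≤ Q * (ε / (2 * c)) := by
      have e : ℓ t = (1 - t) / 2 * ℓ₁ + (1 + t) / 2 * ℓ₂ := by simp only [hℓ]; ring
      have t1 : 0 ≤ (1 - t) / 2 := by linarith [ht.2]
      have t2 : 0 ≤ (1 + t) / 2 := by linarith [ht.1]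
      rw [e, abs_le]
      constructor
      · linarith [mul_le_mul_of_nonneg_left l₁.1 t1, mul_le_mul_of_nonneg_left l₂.1 t2]
      · linarith [mul_le_mul_of_nonneg_left l₁.2 t1, mul_le_mul_of_nonneg_left l₂.2 t2]
    have h2 : Q * (ε / (2 * c)) ≤ Q / (2 * c) * Λ := by
      calc Q * (ε / (2 * c)) = Q / (2 * c) * ε := by ring
        _ ≤ _ := by gcongr
    rw [← mul_pow, ← sq_abs]
    exact pow_le_pow_left₀ (abs_nonneg _) (h1.trans h2) 2
  set p : ℝ → ℝ := fun t => q t + ((ℓ₁ + ℓ₂) / 2 + (ℓ₂ - ℓ₁) / 2 * t) with hpdef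
  have hpG : ControlledBy p (fun t => G t + Q) := by
    apply hqG.add_affine hGL
    rw [abs_le]; constructor <;> linarith
  have hpc : ContinuousOn p (Set.Icc (-1) 1) := by
    apply ContinuousOn.add
    · exact hFc.div hBc fun t ht => (hbmin.trans_le (hBmin t ht)).ne'
    · fun_prop
  set w := layers (-q (-1)) (-q 1) (β₁ / ε) (β₂ / ε) with hw
  set y := shishkinNode θ ε (4 * m) with hy
  have hwerr : ∀ t ∈ dom, |w t - interp (4 * m) y w t| ≤ K * Λ ∧
      ε * |layers' (-q (-1)) (-q 1) (β₁ / ε) (β₂ / ε) t - interpDeriv (4 * m) y w t| ≤ K * Λ :=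
    fun t ht => layers_interp_error hm hε hθ0 hc0 (by linarith)
      (by rw [abs_neg]; exact hqQ _ mL) (by rw [abs_neg]; exact hqQ _ mR) hcβ₁ hcβ₂ hβ₁κ hβ₂κ ht
  refine ⟨p + w, layers' (-q (-1)) (-q 1) (β₁ / ε) (β₂ / ε), ?_, ?_, contDiff_layers' _ _ _ _, ?_⟩
  · simp only [Pi.add_apply, hpdef, hw, layers, layer, hℓ₁, hℓ₂, hE₁, hE₂, mul_neg, mul_one,
      neg_neg, sub_self, Real.exp_zero]
    ring
  · simp only [Pi.add_apply, hpdef, hw, layers, layer, hℓ₁, hℓ₂, hE₁, hE₂, mul_one,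
      sub_self, Real.exp_zero]
    ring
  set Lf : ℝ → ℝ := fun t => (1 + t) * Real.exp (-(2 * (β₁ / ε)) * (1 + t)) with hLf
  set Rf : ℝ → ℝ := fun t => (1 - t) * Real.exp (-(2 * (β₂ / ε)) * (1 - t)) with hRf
  have hint_p := ((memLp_dom_of_continuousOn hpc).sub
    (hasWeakDeriv_interp (4 * m) y p).memLp).integrable_sq
  have hint_d := (memLp_interpDeriv (4 * m) y p).integrable_sq
  have hint_L : IntegrableOn Lf dom := integrableOn_dom_of_continuous (by fun_prop)
  have hint_R : IntegrableOn Rf dom := integrableOn_dom_of_continuous (by fun_prop)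
  obtain ⟨hint, split⟩ := integral_dom_linear_combination hint_p hint_L hint_R hint_d
    (a₀ * Λ ^ 2) a₁ a₂ (2 * ε ^ 2)
  simp only [Pi.sub_apply] at hint split
  have pw : ∀ t ∈ dom, (F t - B t * interp (4 * m) y (p + w) t +
        ε ^ 2 * deriv (layers' (-q (-1)) (-q 1) (β₁ / ε) (β₂ / ε)) t) ^ 2 / bmin +
      ε ^ 2 * (layers' (-q (-1)) (-q 1) (β₁ / ε) (β₂ / ε) t -
        interpDeriv (4 * m) y (p + w) t) ^ 2 ≤
      a₀ * Λ ^ 2 + a₁ * (p t - interp (4 * m) y p t) ^ 2 + a₂ * (Lf t + Rf t) +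
        2 * ε ^ 2 * interpDeriv (4 * m) y p t ^ 2 := by
    intro t ht
    have ht' := Set.Ioo_subset_Icc_self ht
    obtain ⟨w1, w2⟩ := hwerr t ht
    have hl := hℓle t ht'
    have hL : ((B (-1) - B t) * layer (-q (-1)) (-(β₁ / ε)) (β₁ / ε) t) ^ 2 ≤
        T * Q ^ 2 * Lf t := left_layer_residual_le hB hgB (k := β₁ / ε) (A := -q (-1)) (Q := Q)
      (by rw [abs_neg]; exact hqQ _ mL) ht'
    have hR : ((B 1 - B t) * layer (-q 1) (β₂ / ε) (β₂ / ε) t) ^ 2 ≤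
        T * Q ^ 2 * Rf t := right_layer_residual_le hB hgB (k := β₂ / ε) (A := -q 1) (Q := Q)
      (by rw [abs_neg]; exact hqQ _ mR) ht'
    rw [hp.interp_add _ _ ht, hp.interpDeriv_add _ _ ht, (hasDerivAt_layers' _ _ _ _ t).deriv]
    set Ip := interp (4 * m) y p t
    set Iw := interp (4 * m) y w t
    set dp := interpDeriv (4 * m) y p t
    set dw := interpDeriv (4 * m) y w t
    set wl := layer (-q (-1)) (-(β₁ / ε)) (β₁ / ε) t with hwl
    set wr := layer (-q 1) (β₂ / ε) (β₂ / ε) t with hwr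
    set w't := layers' (-q (-1)) (-q 1) (β₁ / ε) (β₂ / ε) t
    have hBt : B t ≠ 0 := (hbmin.trans_le (hBmin t ht')).ne'
    have eF : F t = B t * (p t - ℓ t) := by
      simp only [hpdef, hℓ, hq]; field_simp; ring
    have ewt : w t = wl + wr := rfl
    have e2 : ε ^ 2 * layers'' (-q (-1)) (-q 1) (β₁ / ε) (β₂ / ε) t =
        B (-1) * wl + B 1 * wr := by
      have s1 : β₁ ^ 2 = B (-1) := Real.sq_sqrt hB1pos.le
      have s2 : β₂ ^ 2 = B 1 := Real.sq_sqrt hB2pos.le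
      simp only [layers'']
      rw [← s1, ← s2]
      field_simp
      rfl
    have eA : F t - B t * (Ip + Iw) + ε ^ 2 * layers'' (-q (-1)) (-q 1) (β₁ / ε) (β₂ / ε) t =
        -(B t * ℓ t) + B t * (p t - Ip) + B t * (w t - Iw) + (B (-1) - B t) * wl +
          (B 1 - B t) * wr := by
      rw [e2, eF, ewt]; ring
    clear_value Ip Iw dp dw wl wr w't Lf Rf K Λ Q c T p w ℓ
    have hB2 : B t ^ 2 ≤ M ^ 2 := by
      rw [← sq_abs]; exact pow_le_pow_left₀ (abs_nonneg _) (hBM t ht') 2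
    have q1 : (-(B t * ℓ t)) ^ 2 ≤ M ^ 2 * ((Q / (2 * c)) ^ 2 * Λ ^ 2) := by
      rw [neg_sq, mul_pow]; gcongr
    have q2 : (B t * (p t - Ip)) ^ 2 ≤ M ^ 2 * (p t - Ip) ^ 2 := by
      rw [mul_pow]; gcongr
    have q3 : (B t * (w t - Iw)) ^ 2 ≤ M ^ 2 * (K * Λ) ^ 2 := by
      rw [mul_pow, ← sq_abs (w t - Iw)]; gcongr
    have q4 : ε ^ 2 * (w't - dw) ^ 2 ≤ (K * Λ) ^ 2 := by
      rw [← sq_abs (w't - dw), ← mul_pow]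
      exact pow_le_pow_left₀ (by positivity) w2 2
    have q5 := mul_sq_sub_add_le (d := dp) q4
    rw [eA]
    have q7 := sq_sum_five_div_le hbmin q1 q2 q3 hL hR
    refine (add_le_add q7 q5).trans (le_of_eq ?_)
    rw [ha₀, ha₁, ha₂]
    ring
  have step := integral_mono_of_nonneg (μ := volume.restrict dom)
    (Filter.Eventually.of_forall fun t => by positivity) hint
    ((ae_restrict_mem measurableSet_dom).mono pw)
  refine step.trans ((le_of_eq split).trans ?_)
  have f1 := hp.integral_interp_sq_le hpG hGQ (memLp_dom_of_continuousOn hpc)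
    (fun j _ => shishkinNode_step_le hm hθ0 hε j)
  have f2 := hp.integral_interpDeriv_sq_le hpG hGQ
  rw [← hS] at f1 f2
  clear_value c
  have lay : ∀ β, c ≤ β → 1 / (4 * (β / ε) ^ 2) ≤ Λ ^ 2 / (4 * bmin) := by
    intro β hβ
    have hβ0 := hc0.trans_le hβ
    have e : 1 / (4 * (β / ε) ^ 2) = ε ^ 2 / (4 * β ^ 2) := by field_simp
    rw [e, ← hc2]
    gcongr
  have f3 : ∫ t in dom, Lf t ≤ _ := (integral_left_layer_le (div_pos (hc0.trans_le hcβ₁) hε)).trans (lay β₁ hcβ₁)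
  have f4 : ∫ t in dom, Rf t ≤ _ := (integral_right_layer_le (div_pos (hc0.trans_le hcβ₂) hε)).trans (lay β₂ hcβ₂)
  clear_value C2 a₀ a₁ a₂ S Lf Rf p w Λ n
  have f5 : 4 * (1 / (m : ℝ)) ^ 2 ≤ 64 * Λ ^ 2 := by
    have e : 1 / (m : ℝ) = 4 * n⁻¹ := by rw [hn4]; field_simp
    rw [e, show 4 * (4 * n⁻¹) ^ 2 = 64 * n⁻¹ ^ 2 by ring]
    gcongr
  have f6 : ε ^ 2 ≤ Λ ^ 2 := pow_le_pow_left₀ hε.le hεΛ 2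
  have g1 := mul_le_mul_of_nonneg_left (f1.trans (mul_le_mul_of_nonneg_right f5 hS0)) ha₁0
  have g2 := mul_le_mul_of_nonneg_left (add_le_add f3 f4) ha₂0
  have g3 := mul_le_mul f6 f2 (integral_nonneg fun t => sq_nonneg _) (sq_nonneg Λ)
  have e : C2 * Λ ^ 2 = Λ ^ 2 + 2 * a₀ * Λ ^ 2 + a₁ * (64 * Λ ^ 2 * S) +
      a₂ * (Λ ^ 2 / (4 * bmin) + Λ ^ 2 / (4 * bmin)) + 2 * (Λ ^ 2 * S) := by
    rw [hC2]; ring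
  rw [e]
  linarith [sq_nonneg Λ]

end SingPert

theorem proposition3p1 (b f : ℝ → ℝ) (bmin : ℝ)
    (hb : SingPert.MemH1 b) (hf : SingPert.MemH1 f) (hbmin : 0 < bmin)
    (hlower : ∀ᵐ x ∂(MeasureTheory.volume.restrict SingPert.dom), bmin ≤ b x) :
    ∃ C : ℝ, 0 < C ∧ ∀ ε : ℝ, 0 < ε → ε ≤ 1 →
      ∀ N : ℕ, 1 ≤ N → 4 ∣ N → (N : ℝ) ≤ 1 / ε →
      ∀ u uh : ℝ → ℝ, SingPert.IsWeakSolution ε b f u →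
        SingPert.IsGalerkin ε b f N (SingPert.shishkinMesh bmin ε N) uh →
        SingPert.energyNorm ε b (u - uh) ≤ C * (N : ℝ)⁻¹ * Real.log N := by
  open SingPert in
  obtain ⟨gB, hgB⟩ := hb
  obtain ⟨gF, hgF⟩ := hf
  obtain ⟨cB, hbB⟩ := hgB.exists_primitive
  obtain ⟨cF, hfF⟩ := hgF.exists_primitive
  have hBc := continuousOn_primitive (intervalIntegrable_of_memLp_dom hgB.memLp_deriv) cB
  have hFc := continuousOn_primitive (intervalIntegrable_of_memLp_dom hgF.memLp_deriv) cF
  have hBmin : ∀ t ∈ Set.Icc (-1 : ℝ) 1, bmin ≤ primitive cB gB t := by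
    have h := eqOn_Icc_of_ae_eq (hBc.sup (continuousOn_const (c := bmin))) hBc (by
      filter_upwards [hlower, hbB] with t h1 h2
      rw [← h2]
      exact sup_eq_left.2 h1)
    intro t ht
    exact sup_eq_left.1 (h ht)
  obtain ⟨M₁, hM₁⟩ := isCompact_Icc.exists_bound_of_continuousOn hBc
  obtain ⟨M₂, hM₂⟩ := isCompact_Icc.exists_bound_of_continuousOn hFc
  obtain ⟨C, hC, hmain⟩ := exists_interp_residual_le (M := max M₁ M₂) hbmin hFc hBc
    (controlledBy_primitive hgF.memLp_deriv cF) (controlledBy_primitive hgB.memLp_deriv cB)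
    hgF.memLp_deriv.abs hgB.memLp_deriv.abs hBmin
    (fun t ht => (hM₁ t ht).trans (le_max_left _ _))
    (fun t ht => (hM₂ t ht).trans (le_max_right _ _))
  refine ⟨C, hC, ?_⟩
  rintro ε hε - N hN ⟨m, rfl⟩ hNε u uh hu huh
  have hm : 0 < m := by omega
  have hN0 : (0 : ℝ) < ((4 * m : ℕ) : ℝ) := by positivity
  obtain ⟨P, ψ, hP, hP', hψ, hres⟩ := hmain ε hε m hm (by
    rw [le_inv_comm₀ hε hN0, ← one_div]; exact hNε)
  have hpart : IsPartition (4 * m) (shishkinMesh bmin ε (4 * m)) :=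
    isPartition_shishkinNode hm (by unfold betaStar; positivity) hε
  have hV := hpart.memP1Zero_interp hP hP'
  have hgV := hasWeakDeriv_interp (4 * m) (shishkinMesh bmin ε (4 * m)) P
  have hbm := hgB.memLp.aestronglyMeasurable
  have hbM : ∀ᵐ x ∂(volume.restrict dom), ‖b x‖ ≤ M₁ := by
    filter_upwards [hbB, ae_restrict_mem measurableSet_dom] with t h1 h2
    rw [h1]
    exact hM₁ t (Set.Ioo_subset_Icc_self h2)
  have s1 := energy_le_of_isGalerkin hbm (hlower.mono fun t ht => hbmin.le.trans ht) hbM hu huh hV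
    hgV
  have s2 := energy_le_residual hbmin hbm hlower hbM hgF.memLp hu hV.1 hgV hψ
  have s3 : _ = _ := integral_congr_ae (μ := volume.restrict dom)
    (f := fun t => (f t - b t * interp (4 * m) (shishkinMesh bmin ε (4 * m)) P t +
            ε ^ 2 * deriv ψ t) ^ 2 / bmin +
          ε ^ 2 * (ψ t - interpDeriv (4 * m) (shishkinMesh bmin ε (4 * m)) P t) ^ 2)
    (g := fun t => (primitive cF gF t -
            primitive cB gB t * interp (4 * m) (shishkinMesh bmin ε (4 * m)) P t +
            ε ^ 2 * deriv ψ t) ^ 2 / bmin +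
          ε ^ 2 * (ψ t - interpDeriv (4 * m) (shishkinMesh bmin ε (4 * m)) P t) ^ 2) (by
      filter_upwards [hbB, hfF] with t h1 h2
      rw [h1, h2])
  have hlog : 0 ≤ Real.log ((4 * m : ℕ) : ℝ) := Real.log_natCast_nonneg _
  rw [energyNorm, mul_assoc]
  apply Real.sqrt_le_iff.2 ⟨by positivity, ?_⟩
  rw [mul_pow]
  exact s1.trans (s2.trans (s3.le.trans hres))
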